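/- Setting. Let $I$ be a finite alphabet, $A=(a(i,j))\in\{0,1\}^{I\times I}$, and let $\Sigma=\{\omega\in I^{\mathbb N}: a(\omega_k,\omega_{k+1})=1\ \forall k\}$ be the Markov shift with left shift $\sigma$. Let $\Sigma^*$ be the set of nonempty finite admissible words and, for $\omega\in\Sigma^*$ of length $|\omega|$, let $[\omega]\subset\Sigma$ be the cylinder of points with initial block $\omega$. Let $G$ be a countable discrete group with counting measure $\lambda$, let $I^*$ be the free semigroup of nonempty finite words over $I$, and let $\Psi:I^*\to G$ be a semigroup homomorphism such that for all $a,b\in I$ there is $\gamma\in(\Psi^{-1}\{\mathrm{id}\}\cap\Sigma^*)\cup\{\emptyset\}$ with $a\gamma b\in\Sigma^*$. Let $\varphi:\Sigma\to\mathbb R$ be Hölder continuous, that is, for some $\alpha>0$ and $K$ one has $|\varphi(\omega)-\varphi(\tau)|\le K\mathrm e^{-\alpha n}$ whenever $n\ge1$ and $\omega,\tau$ agree in their first $n$ coordinates. For $\mathcal C\subset\Sigma^*$ put $$\mathcal P(\varphi,\mathcal C)=\limsup_{T\to\infty}\frac1T\log\sum_{\omega\in\mathcal C,\ T-1<|\omega|\le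 T}\exp\Big(\sup_{\tau\in[\omega]}\sum_{k=0}^{|\omega|-1}\varphi(\sigma^k\tau)\Big)\in[-\infty,\infty],\qquad \mathcal P(\varphi)=\mathcal P(\varphi,\Sigma^*).$$ Let $\mu_\varphi$ be the $\sigma$-invariant Gibbs measure of $\varphi$, that is, the $\sigma$-invariant Borel probability measure such that for some $C>0$, $$C^{-1}\le\mu_\varphi[\omega]\Big/\exp\Big(\sum_{k=0}^{|\omega|-1}\varphi(\sigma^k\tau)-|\omega|\mathcal P(\varphi)\Big)\le C$$ for all $\omega\in\Sigma^*$ and $\tau\in[\omega]$. Let $\mathcal L_\varphi f(x)=\sum_{\sigma y=x}\mathrm e^{\varphi(y)}f(y)$, and let $h:\Sigma\to(0,\infty)$ be a Hölder continuous function with $\mathcal L_\varphi h=\mathrm e^{\mathcal P(\varphi)}h$ (it is unique up to a positive factor). Let $(\sigma\rtimes\Psi)(\omega,g)=(\sigma\omega,g\Psi(\omega_1))$ on $\Sigma\times G$, with projections $\pi_1,\pi_2$ to $\Sigma$ and $G$. On the real Hilbert space $L^2=L^2(\Sigma\times G,\mu_\varphi\times\lambda)$ let $Uf=f\circ(\sigma\rtimes\Psi)$,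 $M f=f\cdot(h\circ\pi_1)$, and $$\mathcal L_{\varphi\circ\pi_1}=\mathrm e^{\mathcal P(\varphi)}\,M\,U^*M^{-1}$$ (which does not change if $h$ is multiplied by a positive constant). For a bounded operator $T$ on a closed subspace of $L^2$, $\rho(T)$ denotes its spectral radius, that is, the spectral radius of its complexification. A bounded operator $T$ on a closed subspace $V\subset L^2$ that maps non-negative functions in $V$ to non-negative functions is asymptotically self-adjoint if there are $c_m>0$ and $N_m\in\mathbb N_0$ $(m\ge1)$ with $c_m^{1/m}\to1$ and $N_m/m\to0$ such that $$(T^nf,g)\le c_n\sum_{i=0}^{N_n}(f,T^{n+i}g)$$ for all non-negative $f,g\in V$ and all $n\ge1$. Statement. Suppose that $\mathcal L_\varphi\mathbb 1=\mathbb 1$ and let $V\subset L^2$ be a closed linear subspace with $\mathcal L_{\varphi\circ\pi_1}(V)\subset V$, such that $f^-=\max(-f,0)\in V$ for all $f\in V$, and $\mathbb 1_{\{\pi_2=g\}}\in V$ for all $g\in G$. (The restriction $\mathcal L_{\varphi\circ\pi_1}|_V$ automatically maps non-negative functions to non-negative functions.) If $\mathcal L_{\varphi\circ\pi_1}|_V$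 is asymptotically self-adjoint, then $$\sup_{g\in G}\mathcal P\big(\varphi,\Psi^{-1}\{g\}\cap\Sigma^*\big)=\log\rho\big(\mathcal L_{\varphi\circ\pi_1}|_V\big).$$ -/

import Mathlib

open MeasureTheory Filter Topology
open scoped ENNReal InnerProductSpace BoundedContinuousFunction

noncomputable section

/-! ### Markov shifts -/

/-- The one-sided Markov shift over the alphabet `I` with incidence relation `A`
(`A i j` means that the entry `a(i,j)` of the incidence matrix is `1`).
Coordinates are indexed by `0, 1, 2, …`. -/
def MarkovShift {I : Type*} (A : I → I → Prop) : Type _ :=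
  {ω : ℕ → I // ∀ n, A (ω n) (ω (n + 1))}

namespace MarkovShift

variable {I : Type*} {A : I → I → Prop}

/-- The `n`-th coordinate of a point of the shift space. -/
def coord (ω : MarkovShift A) (n : ℕ) : I := ω.1 n

/-- The subspace topology of the product topology of the discrete topology on `I`. -/
instance : TopologicalSpace (MarkovShift A) :=
  TopologicalSpace.induced (fun ω => ω.1) (@Pi.topologicalSpace ℕ (fun _ => I) (fun _ => ⊥))

/-- The Borel `σ`-algebra. -/
instance : MeasurableSpace (MarkovShift A) := borel _

instance : BorelSpace (MarkovShift A) := ⟨rfl⟩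

/-- The left shift map. -/
def shift (ω : MarkovShift A) : MarkovShift A :=
  ⟨fun n => ω.1 (n + 1), fun n => ω.2 (n + 1)⟩

/-- The cylinder set `[w]` of all points with initial block `w`. -/
def cylinder (A : I → I → Prop) (w : List I) : Set (MarkovShift A) :=
  {ω | ∀ (i : ℕ) (hi : i < w.length), ω.coord i = w[i]}

/-- The set `Σ*` of admissible words of length at least one. -/
def words (A : I → I → Prop) : Set (List I) :=
  {w | w ≠ [] ∧ w.IsChain A}

/-- Hölder continuity: for some `α > 0` there is `K` such that `|f ω - f τ| ≤ K e^{-α n}` whenever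
`ω` and `τ` agree in the first `n ≥ 1` coordinates. -/
def IsHolder (f : MarkovShift A → ℝ) : Prop :=
  ∃ α > 0, ∃ K : ℝ, ∀ n : ℕ, 1 ≤ n → ∀ ω τ : MarkovShift A,
    (∀ i < n, ω.coord i = τ.coord i) → |f ω - f τ| ≤ K * Real.exp (-α * n)

/-- `S_w f = sup_{τ ∈ [w]} S_{|w|} f (τ)`, where `S_n f` is the `n`-th ergodic sum. -/
def wordSum (f : MarkovShift A → ℝ) (w : List I) : ℝ :=
  ⨆ τ : cylinder A w, birkhoffSum shift f w.length τ.1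

/-- The `ψ`-induced pressure of `φ` with respect to `C`, with window size `η`:
`limsup_{T → ∞} (1/T) log ∑_{w ∈ C, T - η < S_w ψ ≤ T} exp (S_w φ)`, an extended real number. -/
def inducedPressure (η : ℝ) (ψ φ : MarkovShift A → ℝ) (C : Set (List I)) : EReal :=
  limsup (fun T : ℝ => ((1 / T : ℝ) : EReal) *
    ENNReal.log (∑' w : {w : List I // w ∈ C ∧ T - η < wordSum ψ w ∧ wordSum ψ w ≤ T},
      ENNReal.ofReal (Real.exp (wordSum φ w.1)))) atTop

/-- The pressure `𝒫(φ, C)`, that is, the induced pressure for `ψ = 1`. As `S_w 1 = |w|`, the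
window size `1` means that exactly the words of length `⌊T⌋` are used. -/
def pressure (φ : MarkovShift A → ℝ) (C : Set (List I)) : EReal :=
  inducedPressure 1 (fun _ => 1) φ C

/-- The pressure `𝒫(φ) = 𝒫(φ, Σ*)` as a real number (it is finite for bounded `φ`, a finite
alphabet and a nonempty shift space). -/
def totalPressure (φ : MarkovShift A → ℝ) : ℝ := (pressure φ (words A)).toReal

/-- The Gibbs property of a measure with respect to the potential `φ`. -/
def IsGibbs (φ : MarkovShift A → ℝ) (μ : Measure (MarkovShift A)) : Prop :=
  ∃ C : ℝ, 0 < C ∧ ∀ w ∈ words A, ∀ τ ∈ cylinder A w,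
    C⁻¹ ≤ μ.real (cylinder A w) /
        Real.exp (birkhoffSum shift φ w.length τ - w.length * totalPressure φ) ∧
    μ.real (cylinder A w) /
        Real.exp (birkhoffSum shift φ w.length τ - w.length * totalPressure φ) ≤ C

/-- The Perron-Frobenius operator `L_φ f (x) = ∑_{σ y = x} e^{φ(y)} f(y)` on functions on the shift
space. The sum is finite if the alphabet is. -/
def transfer (φ f : MarkovShift A → ℝ) (x : MarkovShift A) : ℝ :=
  ∑' y : {y : MarkovShift A // shift y = x}, Real.exp (φ y.1) * f y.1

lemma continuous_letter {X : Type*} [TopologicalSpace X] (ψ : I → X) (n : ℕ) :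
    Continuous (fun ω : MarkovShift A => ψ (ω.coord n)) := by
  let _ : TopologicalSpace I := ⊥
  have _ : DiscreteTopology I := ⟨rfl⟩
  have h : Continuous (fun ω : MarkovShift A => ω.1) := continuous_induced_dom
  exact continuous_of_discreteTopology.comp ((continuous_apply n).comp h)

/-! ### Group extensions -/

variable {G : Type*} [Group G]

/-- The connecting condition on `Ψ`: for all letters `a, b` there is a word `γ`, empty or admissible
with `Ψ(γ) = id`, such that `aγb` is admissible. -/
def IdConnected (A : I → I → Prop) (Ψ : FreeMonoid I →* G) : Prop :=
  ∀ a b : I, ∃ γ : List I, (γ = [] ∨ γ ∈ words A ∧ Ψ (FreeMonoid.ofList γ) = 1) ∧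
    a :: (γ ++ [b]) ∈ words A

/-- The set `Ψ⁻¹{g} ∩ Σ*`. -/
def fibreWords (A : I → I → Prop) (Ψ : FreeMonoid I →* G) (g : G) : Set (List I) :=
  {w | w ∈ words A ∧ Ψ (FreeMonoid.ofList w) = g}

/-- The group-extended Markov system `(ω, g) ↦ (σ ω, g Ψ(ω₁))`. -/
def skew (Ψ : FreeMonoid I →* G) (x : MarkovShift A × G) : MarkovShift A × G :=
  (shift x.1, x.2 * Ψ (FreeMonoid.of (x.1.coord 0)))

variable [Countable G] [MeasurableSpace G] [DiscreteMeasurableSpace G]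

/-- The measure `μ × λ` on `Σ × G`, with `λ` the counting measure. -/
abbrev extMeasure (G : Type*) [MeasurableSpace G] (μ : Measure (MarkovShift A)) :
    Measure (MarkovShift A × G) :=
  μ.prod Measure.count

lemma measurePreserving_skew (Ψ : FreeMonoid I →* G) {μ : Measure (MarkovShift A)}
    [IsProbabilityMeasure μ] (hμ : MeasurePreserving shift μ μ) :
    MeasurePreserving (skew Ψ) (extMeasure G μ) (extMeasure G μ) := by
  have hm : Measurable (fun ω : MarkovShift A => Ψ (FreeMonoid.of (ω.coord 0))) := by
    let _ : TopologicalSpace G := ⊥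
    have _ : DiscreteTopology G := ⟨rfl⟩
    have _ : BorelSpace G := inferInstance
    exact (continuous_letter (fun i => Ψ (FreeMonoid.of i)) 0).measurable
  refine MeasurePreserving.skew_product (f := shift)
    (g := fun ω g => g * Ψ (FreeMonoid.of (ω.coord 0))) hμ ?_ (ae_of_all _ fun ω => ?_)
  · exact (Measurable.of_discrete (f := fun p : G × G => p.1 * p.2)).comp
      (measurable_snd.prodMk (hm.comp measurable_fst))
  · exact ((measurePreserving_mul_right Measure.count (Ψ (FreeMonoid.of (ω.coord 0))))).map_eq

/-! ### Operators on `L²(Σ × G, μ × λ)` -/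

/-- The real Hilbert space `L²(Σ × G, μ × λ)`. -/
abbrev L2 (G : Type*) [MeasurableSpace G] (μ : Measure (MarkovShift A)) : Type _ :=
  Lp ℝ 2 (extMeasure G μ)

/-- The Koopman operator `U f = f ∘ (σ ⋊ Ψ)`. -/
def koopman (Ψ : FreeMonoid I →* G) {μ : Measure (MarkovShift A)}
    [IsProbabilityMeasure μ] (hμ : MeasurePreserving shift μ μ) : L2 G μ →L[ℝ] L2 G μ :=
  (Lp.compMeasurePreservingₗᵢ ℝ (skew Ψ) (measurePreserving_skew Ψ hμ)).toContinuousLinearMap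

lemma memLp_top_comp_fst {G : Type*} [MeasurableSpace G] (μ : Measure (MarkovShift A))
    (h : MarkovShift A →ᵇ ℝ) :
    MemLp (fun x : MarkovShift A × G => h x.1) ∞ (extMeasure G μ) :=
  memLp_top_of_bound (h.continuous.measurable.comp measurable_fst).aestronglyMeasurable ‖h‖
    (ae_of_all _ fun x => h.norm_coe_le_norm x.1)

/-- The multiplication operator `M_{h ∘ π₁} f = f · (h ∘ π₁)` for a bounded continuous `h`. -/
def mulOp (G : Type*) [MeasurableSpace G] (μ : Measure (MarkovShift A)) (h : MarkovShift A →ᵇ ℝ) :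
    L2 G μ →L[ℝ] L2 G μ :=
  (ContinuousLinearMap.mul ℝ ℝ).holderL (extMeasure G μ) ∞ 2 2
    ((memLp_top_comp_fst μ h).toLp _)

/-- The Perron-Frobenius operator
`L_{φ ∘ π₁} = e^{𝒫(φ)} M_{h ∘ π₁} ∘ U* ∘ (M_{h ∘ π₁})⁻¹`, where `h` is a positive eigenfunction
of `L_φ`. As `h` is bounded away from zero, `M_{h ∘ π₁}` is invertible and `Ring.inverse` is its
inverse in the algebra of bounded operators. -/
def perronFrobenius (Ψ : FreeMonoid I →* G) (φ : MarkovShift A → ℝ) (h : MarkovShift A →ᵇ ℝ)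
    {μ : Measure (MarkovShift A)} [IsProbabilityMeasure μ] (hμ : MeasurePreserving shift μ μ) :
    L2 G μ →L[ℝ] L2 G μ :=
  Real.exp (totalPressure φ) •
    (mulOp G μ h * ContinuousLinearMap.adjoint (koopman Ψ hμ) * Ring.inverse (mulOp G μ h))

lemma extMeasure_fibre_ne_top {G : Type*} [Countable G] [MeasurableSpace G]
    [DiscreteMeasurableSpace G] (μ : Measure (MarkovShift A))
    [IsProbabilityMeasure μ] (g : G) :
    extMeasure G μ (Prod.snd ⁻¹' {g}) ≠ ∞ := by
  have : (Prod.snd ⁻¹' {g} : Set (MarkovShift A × G)) = Set.univ ×ˢ {g} := by ext; simp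
  rw [this, Measure.prod_prod]
  simp

/-- The indicator function of the fibre `{π₂ = g}` as an element of `L²(Σ × G, μ × λ)`. -/
def fibreIndicator (μ : Measure (MarkovShift A)) [IsProbabilityMeasure μ] (g : G) : L2 G μ :=
  indicatorConstLp 2 (measurable_snd (measurableSet_singleton g)) (extMeasure_fibre_ne_top μ g) 1

/-- Asymptotic self-adjointness of a bounded operator on a linear subspace `V` of
`L²(Σ × G, μ × λ)`. -/
def IsAsymptoticallySelfAdjoint {μ : Measure (MarkovShift A)} {V : Submodule ℝ (L2 G μ)}
    (T : V →L[ℝ] V) : Prop :=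
  ∃ (c : ℕ → ℝ) (N : ℕ → ℕ), (∀ m, 0 < c m) ∧
    Tendsto (fun m : ℕ => c m ^ (1 / (m : ℝ))) atTop (𝓝 1) ∧
    Tendsto (fun m : ℕ => (N m : ℝ) / m) atTop (𝓝 0) ∧
    ∀ f g : V, 0 ≤ (f : L2 G μ) → 0 ≤ (g : L2 G μ) → ∀ n : ℕ, 1 ≤ n →
      ⟪(T ^ n) f, g⟫_ℝ ≤ c n * ∑ i ∈ Finset.range (N n + 1), ⟪f, (T ^ (n + i)) g⟫_ℝ

end MarkovShift

/-! ### Spectral radius of a bounded operator on a real normed space -/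

section SpectralRadius

variable {E : Type*} [NormedAddCommGroup E] [NormedSpace ℝ E]

/-- Multiplication by `z ∈ ℂ` on the complexification `E × E = E ⊕ iE`:
`(a + ib)(x + iy) = (a x - b y) + i(b x + a y)`. -/
def complexMul (E : Type*) [NormedAddCommGroup E] [NormedSpace ℝ E] (z : ℂ) :
    E × E →L[ℝ] E × E :=
  (z.re • ContinuousLinearMap.fst ℝ E E - z.im • ContinuousLinearMap.snd ℝ E E).prod
    (z.im • ContinuousLinearMap.fst ℝ E E + z.re • ContinuousLinearMap.snd ℝ E E)

/-- The (complex) spectrum of a bounded operator `T` on a real normed space: the spectrum of its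
complexification `x + iy ↦ T x + i T y`. -/
def complexSpectrum (T : E →L[ℝ] E) : Set ℂ :=
  {z | ¬ IsUnit (complexMul E z - T.prodMap T)}

/-- The spectral radius of a bounded operator on a real normed space. -/
def realSpectralRadius (T : E →L[ℝ] E) : ℝ≥0∞ :=
  ⨆ z ∈ complexSpectrum T, (‖z‖₊ : ℝ≥0∞)

end SpectralRadius

end

/-! Normalization makes the operator an adjoint. Since `L_φ 1 = 1`, the operator `L_φ` averages over
preimages. A maximum principle and the density of backward orbits then force zero pressure and
constant `h` (`eigenfunction_eq_const`), so the operator is the adjoint of the Koopman isometry. Let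
T be its restriction to V. The coefficient of `T ^ n` between the fibre indicators of a and b is the
μ-measure of the points whose initial n-word has image `a⁻¹ * b`. By the Gibbs property this is
comparable to the sum defining the pressure of that fibre. The pressures are thus exponential growth
rates of matrix coefficients, and Cauchy-Schwarz with Gelfand's formula gives "≤".

For "≥", coefficient growth has to control operator norms. Let b < 0 exceed all pressures and put `r
= exp b`. Coefficients `⟪T^m f, f⟫` are O(r^m) for non-negative f dominated by a multiple of
finitely many fibre indicators, and such f are dense in the cone. On the cone, asymptotic
self-adjointness bounds `S = (T^n)† T^n` by `Q = c_n ∑ T^(2n+i)`. Iterating, `⟪S^k f, f⟫ ≤ ⟪Q^k f,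
f⟫ ≤ D R^k` with `R = c_n (N_n + 1) r^(2n)`. As S is self-adjoint, repeated Cauchy-Schwarz removes D
and yields `‖T^n f‖² ≤ R ‖f‖²` (`norm_apply_sq_le_of_growth`). Density and positivity extend this to
`‖T^n‖² ≤ R` (`norm_pow_sq_le`). The n-th roots of `c_n (N_n + 1)` tend to 1, so Gelfand's formula
concludes. -/

noncomputable section

/-! ### Gelfand's formula for operators on a real Hilbert space -/

section Gelfand

variable {E : Type*} [NormedAddCommGroup E] [InnerProductSpace ℝ E]

/-- The complexification `E ⊕ iE` of a real Hilbert space, with the Hilbert norm. -/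
def Complexified (E : Type*) [NormedAddCommGroup E] [InnerProductSpace ℝ E] : Type _ :=
  WithLp 2 (E × E)

namespace Complexified

instance : NormedAddCommGroup (Complexified E) :=
  inferInstanceAs (NormedAddCommGroup (WithLp 2 (E × E)))

instance [CompleteSpace E] : CompleteSpace (Complexified E) :=
  inferInstanceAs (CompleteSpace (WithLp 2 (E × E)))

/-- The element `x + iy`. -/
def mk (x y : E) : Complexified E := WithLp.toLp 2 (x, y)

/-- The real part. -/
def re (v : Complexified E) : E := WithLp.fst (p := 2) (α := E) (β := E) v

/-- The imaginary part. -/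
def im (v : Complexified E) : E := WithLp.snd (p := 2) (α := E) (β := E) v

@[simp] lemma mk_re (x y : E) : (mk x y).re = x := rfl
@[simp] lemma mk_im (x y : E) : (mk x y).im = y := rfl
@[simp] lemma add_re (u v : Complexified E) : (u + v).re = u.re + v.re := rfl
@[simp] lemma add_im (u v : Complexified E) : (u + v).im = u.im + v.im := rfl
@[simp] lemma zero_re : (0 : Complexified E).re = 0 := rfl
@[simp] lemma zero_im : (0 : Complexified E).im = 0 := rfl

@[ext] lemma ext {u v : Complexified E} (h₁ : u.re = v.re) (h₂ : u.im = v.im) : u = v := by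
  have : (WithLp.equiv 2 (E × E)) u = (WithLp.equiv 2 (E × E)) v := Prod.ext h₁ h₂
  exact (WithLp.equiv 2 (E × E)).injective this

lemma norm_sq (v : Complexified E) : ‖v‖ ^ 2 = ‖v.re‖ ^ 2 + ‖v.im‖ ^ 2 :=
  WithLp.prod_norm_sq_eq_of_L2 (α := E) (β := E) v

instance : SMul ℂ (Complexified E) :=
  ⟨fun z v => mk (z.re • v.re - z.im • v.im) (z.im • v.re + z.re • v.im)⟩

@[simp] lemma smul_re (z : ℂ) (v : Complexified E) :
    (z • v).re = z.re • v.re - z.im • v.im := rfl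
@[simp] lemma smul_im (z : ℂ) (v : Complexified E) :
    (z • v).im = z.im • v.re + z.re • v.im := rfl

instance : Module ℂ (Complexified E) where
  one_smul v := by ext <;> simp
  mul_smul z w v := by
    ext <;> simp only [smul_re, smul_im, Complex.mul_re, Complex.mul_im] <;> module
  smul_zero z := by ext <;> simp
  smul_add z u v := by ext <;> simp <;> module
  add_smul z w v := by ext <;> simp <;> module
  zero_smul v := by ext <;> simp

/-- The cross terms of the real and imaginary parts cancel; this is where the Hilbert norm on `E ×
E` is needed instead of the maximum norm. -/
lemma norm_complex_smul (z : ℂ) (v : Complexified E) : ‖z • v‖ = ‖z‖ * ‖v‖ := by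
  have h : ‖z • v‖ ^ 2 = (‖z‖ * ‖v‖) ^ 2 := by
    rw [mul_pow, norm_sq, norm_sq, Complex.sq_norm, Complex.normSq_apply, smul_re, smul_im,
      norm_sub_sq_real, norm_add_sq_real]
    simp only [norm_smul, mul_pow, Real.norm_eq_abs, sq_abs, inner_smul_left, inner_smul_right,
      conj_trivial]
    ring
  exact (sq_eq_sq₀ (norm_nonneg _) (by positivity)).1 h

instance : NormedSpace ℂ (Complexified E) where
  norm_smul_le z v := (norm_complex_smul z v).le

/-- The complexification of a bounded operator. -/
def map (T : E →L[ℝ] E) : Complexified E →L[ℂ] Complexified E :=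
  LinearMap.mkContinuous
    { toFun := fun v => mk (T v.re) (T v.im)
      map_add' := fun u v => by ext <;> simp
      map_smul' := fun z v => by ext <;> simp }
    ‖T‖ (fun v => by
      refine le_of_sq_le_sq ?_ (by positivity)
      have h₁ := T.le_opNorm v.re
      have h₂ := T.le_opNorm v.im
      rw [mul_pow, norm_sq, norm_sq v]
      simp only [LinearMap.coe_mk, AddHom.coe_mk, mk_re, mk_im]
      rw [mul_add, ← mul_pow, ← mul_pow]
      gcongr)

@[simp] lemma map_re (T : E →L[ℝ] E) (v : Complexified E) : (map T v).re = T v.re := rfl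
@[simp] lemma map_im (T : E →L[ℝ] E) (v : Complexified E) : (map T v).im = T v.im := rfl

lemma map_pow (T : E →L[ℝ] E) (n : ℕ) : map (T ^ n) = map T ^ n := by
  induction n with
  | zero => ext v <;> simp
  | succ n ih => rw [pow_succ, pow_succ, ← ih]; ext v <;> simp

lemma norm_map (T : E →L[ℝ] E) : ‖map T‖ = ‖T‖ := by
  refine le_antisymm (LinearMap.mkContinuous_norm_le _ (norm_nonneg _) _) ?_
  refine T.opNorm_le_bound (norm_nonneg _) fun x => ?_
  have key : ∀ y : E, ‖mk y 0‖ = ‖y‖ := fun y =>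
    (sq_eq_sq₀ (norm_nonneg _) (norm_nonneg _)).1 (by simp [norm_sq])
  have h := (map T).le_opNorm (mk x 0)
  have h' : map T (mk x 0) = mk (T x) 0 := by ext <;> simp
  rwa [h', key, key] at h

/-- On a Banach space invertibility is bijectivity, which depends neither on the choice between the
two norms on `E × E` nor on the scalar field. -/
lemma spectrum_map [CompleteSpace E] (T : E →L[ℝ] E) :
    spectrum ℂ (map T) = complexSpectrum T := by
  ext z
  let e := WithLp.equiv 2 (E × E)
  have key : e ∘ ((algebraMap ℂ (Complexified E →L[ℂ] Complexified E)) z - map T : _ →L[ℂ] _) ∘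
      e.symm = ⇑(complexMul E z - T.prodMap T) := by
    funext p
    rfl
  rw [spectrum.mem_iff, complexSpectrum, Set.mem_ofPred_eq, not_iff_not,
    ContinuousLinearMap.isUnit_iff_bijective, ContinuousLinearMap.isUnit_iff_bijective, ← key]
  exact ((e.comp_bijective _).trans (e.symm.bijective_comp _)).symm

end Complexified

/-- Gelfand's formula for the spectral radius of an operator on a real Hilbert space. -/
theorem tendsto_nnnorm_pow_realSpectralRadius [CompleteSpace E] (T : E →L[ℝ] E) :
    Tendsto (fun n : ℕ => (‖T ^ n‖₊ : ℝ≥0∞) ^ (1 / n : ℝ)) atTop (𝓝 (realSpectralRadius T)) := by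
  have h := spectrum.pow_nnnorm_pow_one_div_tendsto_nhds_spectralRadius (Complexified.map T)
  have h₁ : spectralRadius ℂ (Complexified.map T) = realSpectralRadius T := by
    rw [spectralRadius, Complexified.spectrum_map, realSpectralRadius]
  have h₂ : ∀ n : ℕ, ‖Complexified.map T ^ n‖₊ = ‖T ^ n‖₊ := fun n => by
    rw [← Complexified.map_pow]
    exact NNReal.eq (Complexified.norm_map _)
  simpa only [h₁, h₂] using h

/-- If `b` exceeds the logarithm of the spectral radius, the powers grow at most like `e^{bn}`. -/
theorem exists_norm_pow_le_of_log_lt [CompleteSpace E] (T : E →L[ℝ] E) {b : ℝ}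
    (hb : ENNReal.log (realSpectralRadius T) < b) :
    ∃ D : ℝ, ∀ n : ℕ, ‖T ^ n‖ ≤ D * Real.exp (b * n) := by
  have hb' : realSpectralRadius T < ENNReal.ofReal (Real.exp b) := by
    rw [← ENNReal.log_lt_log_iff, ENNReal.log_ofReal_of_pos (Real.exp_pos _), Real.log_exp]
    exact hb
  have hev := (tendsto_nnnorm_pow_realSpectralRadius T).eventually (gt_mem_nhds hb')
  obtain ⟨n₀, hn₀⟩ := eventually_atTop.1 (hev.and (eventually_ge_atTop 1))
  -- The sum accounts for the finitely many `n < n₀`, the summand 1 for the rest.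
  refine ⟨1 + ∑ i ∈ Finset.range n₀, ‖T ^ i‖ * Real.exp (-(b * i)), fun n => ?_⟩
  have hs : ∀ i ∈ Finset.range n₀, 0 ≤ ‖T ^ i‖ * Real.exp (-(b * i)) := fun i _ => by positivity
  by_cases hn : n < n₀
  · have h := Finset.single_le_sum hs (Finset.mem_range.2 hn)
    calc ‖T ^ n‖ = ‖T ^ n‖ * Real.exp (-(b * n)) * Real.exp (b * n) := by
          rw [mul_assoc, ← Real.exp_add]; simp
      _ ≤ _ := by gcongr; linarith
  · obtain ⟨h, hn1⟩ := hn₀ n (not_lt.1 hn)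
    have hn0 : (n : ℝ) ≠ 0 := by positivity
    have h' := ENNReal.rpow_le_rpow h.le (by positivity : (0 : ℝ) ≤ n)
    rw [← ENNReal.rpow_mul, one_div, inv_mul_cancel₀ hn0, ENNReal.rpow_one,
      ENNReal.ofReal_rpow_of_pos (Real.exp_pos _), ← Real.exp_mul, ← enorm_eq_nnnorm,
      ← ofReal_norm, ENNReal.ofReal_le_ofReal_iff (Real.exp_pos _).le] at h'
    refine h'.trans (le_mul_of_one_le_left (Real.exp_pos _).le ?_)
    linarith [Finset.sum_nonneg hs]

/-- If the powers are bounded by `d n * e^{bn}` with `d` subexponential, then the logarithm of the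
spectral radius is at most `b`. -/
theorem log_realSpectralRadius_le [CompleteSpace E] (T : E →L[ℝ] E) {b : ℝ} {d : ℕ → ℝ}
    (hd : ∀ n, 0 ≤ d n) (hlim : Tendsto (fun n : ℕ => d n ^ (1 / n : ℝ)) atTop (𝓝 1))
    (h : ∀ n : ℕ, 1 ≤ n → ‖T ^ n‖ ≤ d n * Real.exp (b * n)) :
    ENNReal.log (realSpectralRadius T) ≤ b := by
  have hle : realSpectralRadius T ≤ ENNReal.ofReal (Real.exp b) := by
    have hlim' : Tendsto (fun n : ℕ => ENNReal.ofReal (d n ^ (1 / n : ℝ) * Real.exp b)) atTop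
        (𝓝 (ENNReal.ofReal (Real.exp b))) := by
      have := (hlim.mul_const (Real.exp b))
      rw [one_mul] at this
      exact ENNReal.tendsto_ofReal this
    refine le_of_tendsto_of_tendsto (tendsto_nnnorm_pow_realSpectralRadius T) hlim' ?_
    filter_upwards [eventually_ge_atTop 1] with n hn
    have hn0 : (n : ℝ) ≠ 0 := by positivity
    rw [← enorm_eq_nnnorm, ← ofReal_norm,
      ENNReal.ofReal_rpow_of_nonneg (norm_nonneg _) (by positivity)]
    refine ENNReal.ofReal_le_ofReal ?_
    calc ‖T ^ n‖ ^ (1 / n : ℝ) ≤ (d n * Real.exp (b * n)) ^ (1 / n : ℝ) := by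
          gcongr; exact h n hn
      _ = _ := by
          rw [Real.mul_rpow (hd n) (Real.exp_pos _).le, ← Real.exp_mul]
          congr 2
          field_simp
  have := ENNReal.log_le_log hle
  rwa [ENNReal.log_ofReal_of_pos (Real.exp_pos _), Real.log_exp] at this

end Gelfand

/-! ### Operators preserving a self-dual cone -/

section SelfDualCone

variable {E : Type*} [NormedAddCommGroup E] [InnerProductSpace ℝ E]

/-- A self-dual cone in a real Hilbert space for which every vector has an orthogonal decomposition
into a positive and a negative part. -/
structure IsSelfDualCone (K : Set E) : Prop where
  inner_nonneg : ∀ f ∈ K, ∀ g ∈ K, 0 ≤ ⟪f, g⟫_ℝ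
  mem_of_inner_nonneg : ∀ f, (∀ g ∈ K, 0 ≤ ⟪f, g⟫_ℝ) → f ∈ K
  exists_decomposition : ∀ f, ∃ p ∈ K, ∃ q ∈ K, f = p - q ∧ ⟪p, q⟫_ℝ = 0

lemma ContinuousLinearMap.pow_mapsTo {K : Set E} {T : E →L[ℝ] E} (hT : ∀ f ∈ K, T f ∈ K) (n : ℕ) :
    ∀ f ∈ K, (T ^ n) f ∈ K := by
  induction n with
  | zero => exact fun f hf => hf
  | succ n ih => intro f hf; rw [pow_succ]; exact ih _ (hT f hf)

/-- The operator norm bound for a cone preserving operator, given that it suffices to test on the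
cone. -/
lemma IsSelfDualCone.norm_sq_le_of_cone {K : Set E} (hK : IsSelfDualCone K) {A : E →L[ℝ] E} (hA : ∀ f ∈ K, A f ∈ K) {R : ℝ} (hR : 0 ≤ R)
    (h : ∀ f ∈ K, ‖A f‖ ^ 2 ≤ R * ‖f‖ ^ 2) : ‖A‖ ^ 2 ≤ R := by
  have key : ∀ f, ‖A f‖ ^ 2 ≤ R * ‖f‖ ^ 2 := fun f => by
    obtain ⟨p, hp, q, hq, rfl, hpq⟩ := hK.exists_decomposition f
    have hpqK : p + q ∈ K := hK.mem_of_inner_nonneg _ fun g hg => by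
      rw [inner_add_left]
      exact add_nonneg (hK.inner_nonneg _ hp _ hg) (hK.inner_nonneg _ hq _ hg)
    -- Orthogonality gives `‖p + q‖ = ‖p - q‖`, while `⟪A p, A q⟫ ≥ 0` gives `‖A (p - q)‖ ≤ ‖A (p +
    -- q)‖`.
    have h1 := h _ hpqK
    have h2 := hK.inner_nonneg _ (hA p hp) _ (hA q hq)
    rw [map_add, norm_add_sq_real, norm_add_sq_real, hpq] at h1
    rw [map_sub, norm_sub_sq_real, norm_sub_sq_real, hpq]
    linarith
  have : ‖A‖ ≤ √R := A.opNorm_le_bound (Real.sqrt_nonneg _) fun f => by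
    refine le_of_sq_le_sq ?_ (by positivity)
    rw [mul_pow, Real.sq_sqrt hR]
    exact key f
  calc ‖A‖ ^ 2 ≤ √R ^ 2 := by gcongr
    _ = R := Real.sq_sqrt hR

variable [CompleteSpace E]

/-- Spectral bound along a vector: if `⟪(A† A)^k f, f⟫` grows at most like `R^k`, then
`‖A f‖² ≤ R ‖f‖²`. -/
lemma norm_apply_sq_le_of_growth (A : E →L[ℝ] E) (f : E) {R D : ℝ} (hR : 0 ≤ R)
    (h : ∀ k : ℕ, ⟪((ContinuousLinearMap.adjoint A * A) ^ k) f, f⟫_ℝ ≤ D * R ^ k) :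
    ‖A f‖ ^ 2 ≤ R * ‖f‖ ^ 2 := by
  set S := ContinuousLinearMap.adjoint A * A with hS
  have hsym : ∀ x y : E, ⟪S x, y⟫_ℝ = ⟪x, S y⟫_ℝ := fun x y => by
    simp only [hS, mul_apply_eq_comp, ContinuousLinearMap.adjoint_inner_left,
      ContinuousLinearMap.adjoint_inner_right]
  have hsymk : ∀ (k : ℕ) (x y : E), ⟪(S ^ k) x, y⟫_ℝ = ⟪x, (S ^ k) y⟫_ℝ := by
    intro k
    induction k with
    | zero => intro x y; rfl
    | succ k ih =>
      intro x y
      rw [pow_succ, mul_apply_eq_comp, ih, hsym, ← mul_apply_eq_comp,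
        ← pow_succ', ← pow_succ]
  have h1 : ⟪S f, f⟫_ℝ = ‖A f‖ ^ 2 := by
    rw [hS, mul_apply_eq_comp, ContinuousLinearMap.adjoint_inner_left,
      real_inner_self_eq_norm_sq]
  by_contra hlt
  rw [not_le] at hlt
  have hf : 0 < ‖f‖ ^ 2 := by
    have : f ≠ 0 := by rintro rfl; simp at hlt
    positivity
  set q := ‖A f‖ ^ 2 / ‖f‖ ^ 2 with hq
  have hqR : R < q := (lt_div_iff₀ hf).2 hlt
  have hq0 : 0 < q := hR.trans_lt hqR
  -- Cauchy-Schwarz doubles the exponent, so the Rayleigh quotient q of S at f is a lower bound for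
  -- the growth rate; `q > R` then contradicts the bound `D * R ^ k`.
  have hgrow : ∀ j : ℕ, ‖f‖ ^ 2 * q ^ (2 ^ j) ≤ ⟪(S ^ (2 ^ j)) f, f⟫_ℝ := by
    intro j
    induction j with
    | zero => rw [pow_zero, pow_one, pow_one, h1, hq, mul_div_cancel₀ _ hf.ne']
    | succ j ih =>
      have hcs : ⟪(S ^ (2 ^ j)) f, f⟫_ℝ ^ 2 ≤ ‖f‖ ^ 2 * ⟪(S ^ (2 ^ (j + 1))) f, f⟫_ℝ := by
        have e : ⟪(S ^ (2 ^ (j + 1))) f, f⟫_ℝ = ‖(S ^ (2 ^ j)) f‖ ^ 2 := by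
          rw [pow_succ, mul_two, pow_add, mul_apply_eq_comp, hsymk,
            real_inner_self_eq_norm_sq]
        rw [e, mul_comm, ← mul_pow]
        exact sq_le_sq' (by linarith [neg_le_of_abs_le (abs_real_inner_le_norm
          ((S ^ (2 ^ j)) f) f)]) (real_inner_le_norm _ _)
      have hsq := pow_le_pow_left₀ (by positivity) ih 2
      have : ‖f‖ ^ 2 * (‖f‖ ^ 2 * q ^ (2 ^ (j + 1)))
          ≤ ‖f‖ ^ 2 * ⟪(S ^ (2 ^ (j + 1))) f, f⟫_ℝ := by
        refine le_trans (le_of_eq ?_) (hsq.trans hcs)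
        rw [pow_succ 2 j, pow_mul q]; ring
      exact le_of_mul_le_mul_left this hf
  have hbound : ∀ j : ℕ, ‖f‖ ^ 2 * q ^ (2 ^ j) ≤ D * R ^ (2 ^ j) := fun j => (hgrow j).trans (h _)
  rcases hR.eq_or_lt with rfl | hR0
  · have := hbound 0
    simp only [pow_zero, pow_one, mul_zero] at this
    nlinarith
  · have ht : Tendsto (fun j : ℕ => (q / R) ^ (2 ^ j)) atTop atTop :=
      (tendsto_pow_atTop_atTop_of_one_lt ((one_lt_div hR0).2 hqR)).comp
        (tendsto_pow_atTop_atTop_of_one_lt one_lt_two)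
    obtain ⟨j, hj⟩ := (ht.eventually (eventually_gt_atTop (D / ‖f‖ ^ 2))).exists
    rw [div_pow, div_lt_div_iff₀ hf (by positivity)] at hj
    linarith [hbound j]

namespace IsSelfDualCone

variable {K : Set E}

/-- Membership in a self-dual cone is tested by pairing, and pairing moves the adjoint back to T. -/
lemma adjoint_mapsTo (hK : IsSelfDualCone K) {T : E →L[ℝ] E} (hT : ∀ f ∈ K, T f ∈ K) :
    ∀ f ∈ K, ContinuousLinearMap.adjoint T f ∈ K := fun f hf =>
  hK.mem_of_inner_nonneg _ fun g hg => by
    rw [ContinuousLinearMap.adjoint_inner_left]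
    exact hK.inner_nonneg _ hf _ (hT g hg)

/-- If an inequality `⟪S f, g⟫ ≤ ⟪Q f, g⟫` between cone preserving operators holds on the cone,
then it holds for all powers. -/
lemma inner_pow_le_inner_pow (hK : IsSelfDualCone K) {S Q : E →L[ℝ] E} (hS : ∀ f ∈ K, S f ∈ K) (hQ : ∀ f ∈ K, Q f ∈ K)
    (h : ∀ f ∈ K, ∀ g ∈ K, ⟪S f, g⟫_ℝ ≤ ⟪Q f, g⟫_ℝ) (k : ℕ) :
    ∀ f ∈ K, ∀ g ∈ K, ⟪(S ^ k) f, g⟫_ℝ ≤ ⟪(Q ^ k) f, g⟫_ℝ := by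
  induction k with
  | zero => exact fun f _ g _ => le_rfl
  | succ k ih =>
    intro f hf g hg
    rw [pow_succ, pow_succ, mul_apply_eq_comp, mul_apply_eq_comp]
    refine (ih _ (hS f hf) g hg).trans ?_
    rw [← ContinuousLinearMap.adjoint_inner_right (Q ^ k),
      ← ContinuousLinearMap.adjoint_inner_right (Q ^ k)]
    exact h f hf _ (hK.adjoint_mapsTo (ContinuousLinearMap.pow_mapsTo hQ k) g hg)

/-- Norm bound for the `n`-th power of a cone preserving operator that satisfies the inequality of
asymptotic self-adjointness, from the growth of diagonal matrix coefficients on a dense part of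
the cone. -/
theorem norm_pow_sq_le (hK : IsSelfDualCone K) {T : E →L[ℝ] E} (hT : ∀ f ∈ K, T f ∈ K) {n N : ℕ} {c r : ℝ} (hc : 0 < c)
    (hr : 0 ≤ r) (hr1 : r ≤ 1)
    (hasa : ∀ f ∈ K, ∀ g ∈ K,
      ⟪(T ^ n) f, g⟫_ℝ ≤ c * ∑ i ∈ Finset.range (N + 1), ⟪f, (T ^ (n + i)) g⟫_ℝ)
    {G : Set E} (hG : G ⊆ K) (hdense : K ⊆ closure G)
    (hgrow : ∀ f ∈ G, ∃ D : ℝ, ∀ m : ℕ, ⟪(T ^ m) f, f⟫_ℝ ≤ D * r ^ m) :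
    ‖T ^ n‖ ^ 2 ≤ c * (N + 1) * r ^ (2 * n) := by
  have hTn := fun m => ContinuousLinearMap.pow_mapsTo hT m
  set S := ContinuousLinearMap.adjoint (T ^ n) * T ^ n with hS
  -- Q comes from asymptotic self-adjointness applied to g and `T^n f`: the exponent `n + i` is from
  -- the inequality, the last n from `T^n f`.
  set Q : E →L[ℝ] E := c • ∑ i ∈ Finset.range (N + 1), T ^ (n + i + n) with hQ
  have hQin : ∀ f g, ⟪Q f, g⟫_ℝ = c * ∑ i ∈ Finset.range (N + 1), ⟪(T ^ (n + i + n)) f, g⟫_ℝ :=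
    fun f g => by
      simp only [hQ, smul_apply, sum_apply,
        inner_smul_left, conj_trivial, sum_inner]
  have hSK : ∀ f ∈ K, S f ∈ K := fun f hf => hK.adjoint_mapsTo (hTn n) _ (hTn n f hf)
  have hQK : ∀ f ∈ K, Q f ∈ K := fun f hf => hK.mem_of_inner_nonneg _ fun g hg => by
    rw [hQin]
    exact mul_nonneg hc.le (Finset.sum_nonneg fun i _ => hK.inner_nonneg _ (hTn _ f hf) _ hg)
  have hSQ : ∀ f ∈ K, ∀ g ∈ K, ⟪S f, g⟫_ℝ ≤ ⟪Q f, g⟫_ℝ := fun f hf g hg => by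
    rw [hQin, hS, mul_apply_eq_comp, ContinuousLinearMap.adjoint_inner_left,
      real_inner_comm]
    refine (hasa g hg _ (hTn n f hf)).trans (le_of_eq ?_)
    congr 1
    refine Finset.sum_congr rfl fun i _ => ?_
    rw [real_inner_comm, pow_add T (n + i) n, mul_apply_eq_comp]
  set R := c * (N + 1) * r ^ (2 * n) with hRdef
  have hR : 0 ≤ R := by positivity
  have hgood : ∀ f ∈ G, ‖(T ^ n) f‖ ^ 2 ≤ R * ‖f‖ ^ 2 := fun f hf => by
    obtain ⟨D, hD⟩ := hgrow f hf
    have hD0 : 0 ≤ D := by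
      have h0 := hD 0
      rw [pow_zero, pow_zero, mul_one] at h0
      exact (real_inner_self_nonneg (x := f)).trans h0
    refine norm_apply_sq_le_of_growth (T ^ n) f hR (D := D) fun k => ?_
    refine (hK.inner_pow_le_inner_pow hSK hQK hSQ k f (hG hf) f (hG hf)).trans ?_
    -- The extra power of T makes the induction close. Each term of Q raises the exponent by `2n +
    -- i`, and `r ≤ 1` allows i to be dropped.
    have main : ∀ m : ℕ, ⟪(Q ^ k) ((T ^ m) f), f⟫_ℝ ≤ D * R ^ k * r ^ m := by
      induction k with
      | zero => intro m; simpa using hD m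
      | succ k ih =>
        intro m
        have e : (Q ^ (k + 1)) ((T ^ m) f)
            = c • ∑ i ∈ Finset.range (N + 1), (Q ^ k) ((T ^ (n + i + n + m)) f) := by
          rw [pow_succ, mul_apply_eq_comp]
          have e' : Q ((T ^ m) f)
              = c • ∑ i ∈ Finset.range (N + 1), (T ^ (n + i + n + m)) f := by
            simp only [hQ, smul_apply, sum_apply, pow_add T _ m, mul_apply_eq_comp]
          rw [e', map_smul, map_sum]
        rw [e, inner_smul_left, conj_trivial, sum_inner]
        calc c * ∑ i ∈ Finset.range (N + 1), ⟪(Q ^ k) ((T ^ (n + i + n + m)) f), f⟫_ℝ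
            ≤ c * ∑ i ∈ Finset.range (N + 1), D * R ^ k * r ^ (2 * n + m) := by
              gcongr with i
              refine (ih _).trans ?_
              gcongr 1
              exact pow_le_pow_of_le_one hr hr1 (by omega)
          _ = D * R ^ (k + 1) * r ^ m := by
              rw [Finset.sum_const, Finset.card_range, nsmul_eq_mul, pow_succ R, hRdef]
              push_cast
              ring
    simpa using main 0
  refine hK.norm_sq_le_of_cone (hTn n) hR fun f hf => ?_
  -- D depended on f but R does not, so the bound passes to the closure.
  have hcl : IsClosed {f : E | ‖(T ^ n) f‖ ^ 2 ≤ R * ‖f‖ ^ 2} :=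
    isClosed_le (by fun_prop) (by fun_prop)
  exact closure_minimal (fun f hf => hgood f hf) hcl (hdense hf)

end IsSelfDualCone

end SelfDualCone

/-! ### Symbolic dynamics and rigidity of the eigenfunction. -/

namespace MarkovShift

section Dynamics

variable {I : Type*} {A : I → I → Prop}

@[ext] lemma ext_coord {ω τ : MarkovShift A} (h : ∀ n, ω.coord n = τ.coord n) : ω = τ :=
  Subtype.ext (funext h)

@[simp] lemma coord_shift (ω : MarkovShift A) (n : ℕ) : (shift ω).coord n = ω.coord (n + 1) := rfl

lemma coord_iterate_shift (ω : MarkovShift A) (m n : ℕ) :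
    (shift^[m] ω).coord n = ω.coord (n + m) := by
  induction m generalizing n with
  | zero => rfl
  | succ m ih => rw [Function.iterate_succ_apply', coord_shift, ih, add_right_comm, add_assoc]

/-- Every admissible word that can be followed by the first letter of `ω` can be put in front
of `ω`. -/
lemma exists_prepend (ω : MarkovShift A) (w : List I) (hw : (w ++ [ω.coord 0]).IsChain A) :
    ∃ τ ∈ cylinder A w, shift^[w.length] τ = ω := by
  -- The induction must also record the first letter of τ, to which the next letter is attached.
  suffices h : ∃ τ ∈ cylinder A w, shift^[w.length] τ = ω ∧
      (w ++ [ω.coord 0]).head? = some (τ.coord 0) by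
    obtain ⟨τ, h1, h2, -⟩ := h
    exact ⟨τ, h1, h2⟩
  induction w with
  | nil => exact ⟨ω, fun i hi => absurd hi (by simp), rfl, rfl⟩
  | cons a w ih =>
    rw [List.cons_append] at hw
    obtain ⟨hhead, htail⟩ := List.isChain_cons.1 hw
    obtain ⟨τ, hτ, hshift, hτ0⟩ := ih htail
    refine ⟨⟨fun n => n.casesOn a τ.coord, fun n => ?_⟩, ?_, ?_, rfl⟩
    · cases n with
      | zero => exact hhead _ hτ0
      | succ n => exact τ.2 n
    · intro i hi
      cases i with
      | zero => rfl
      | succ i => exact hτ i (by simpa using hi)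
    · exact hshift

variable {G : Type*} [Group G] {Ψ : FreeMonoid I →* G}

/-- Backward orbits are dense. -/
lemma exists_mem_cylinder_iterate_shift (hΨ : IdConnected A Ψ) (ω : MarkovShift A) {w : List I}
    (hw : w ∈ words A) : ∃ τ ∈ cylinder A w, ∃ n, shift^[n] τ = ω := by
  obtain ⟨hne, hchain⟩ := hw
  obtain ⟨v, a, rfl⟩ : ∃ v a, w = v ++ [a] :=
    ⟨w.dropLast, w.getLast hne, (List.dropLast_append_getLast hne).symm⟩
  obtain ⟨γ, -, hγ⟩ := hΨ a (ω.coord 0)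
  obtain ⟨τ, hτ, h⟩ := exists_prepend ω (v ++ a :: γ) (by
    rw [List.append_assoc, List.cons_append]
    exact List.isChain_split.2 ⟨hchain, hγ.2⟩)
  refine ⟨τ, fun i hi => ?_, _, h⟩
  have hlen : i < (v ++ a :: γ).length := by simp at hi ⊢; omega
  rw [hτ i hlen]
  have : v ++ a :: γ = (v ++ [a]) ++ γ := by simp
  simp only [this]
  exact List.getElem_append_left hi

/-- The initial block of length `n`. -/
def initialWord (ω : MarkovShift A) (n : ℕ) : List I := (List.range n).map ω.coord

@[simp] lemma length_initialWord (ω : MarkovShift A) (n : ℕ) : (ω.initialWord n).length = n := by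
  simp [initialWord]

lemma mem_cylinder_iff {ω : MarkovShift A} {w : List I} :
    ω ∈ cylinder A w ↔ ω.initialWord w.length = w := by
  constructor
  · intro h
    refine List.ext_getElem (by simp) fun i h₁ h₂ => ?_
    rw [← h i h₂]
    simp [initialWord]
  · intro h i hi
    have : (ω.initialWord w.length)[i]'(by simpa using hi) = w[i] := by simp only [h]
    rw [← this]
    simp [initialWord]

lemma initialWord_mem_words (ω : MarkovShift A) {n : ℕ} (hn : 1 ≤ n) :
    ω.initialWord n ∈ words A := by
  refine ⟨fun h => ?_, List.isChain_iff_getElem.2 fun i hi => ?_⟩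
  · have := congrArg List.length h
    simp at this
    omega
  · simp only [initialWord, List.getElem_map, List.getElem_range]
    exact ω.2 i

instance [Finite I] : CompactSpace (MarkovShift A) := by
  let _ : TopologicalSpace I := ⊥
  have _ : DiscreteTopology I := ⟨rfl⟩
  have hcl : IsClosed {ω : ℕ → I | ∀ n, A (ω n) (ω (n + 1))} := by
    rw [Set.ofPred_forall]
    refine isClosed_iInter fun n => ?_
    exact (isClosed_discrete {p : I × I | A p.1 p.2}).preimage
      (f := fun ω : ℕ → I => (ω n, ω (n + 1))) (by fun_prop)
  exact hcl.isClosedEmbedding_subtypeVal.compactSpace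

instance [Finite I] (x : MarkovShift A) : Finite {y : MarkovShift A // shift y = x} :=
  Finite.of_injective (fun y => y.1.coord 0) fun y z h => by
    refine Subtype.ext (ext_coord fun n => ?_)
    cases n with
    | zero => exact h
    | succ n => rw [← coord_shift, ← coord_shift, y.2, z.2]

/-- A Hölder continuous positive eigenfunction of a normalized Perron-Frobenius operator has
eigenvalue one and is constant. -/
theorem eigenfunction_eq_const [Finite I] [Nonempty (MarkovShift A)] (hΨ : IdConnected A Ψ)
    {φ h : MarkovShift A → ℝ} {p : ℝ} (hcont : Continuous h) (hh : IsHolder h)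
    (hpos : ∀ ω, 0 < h ω) (heig : ∀ ω, transfer φ h ω = Real.exp p * h ω)
    (hone : ∀ ω, transfer φ (fun _ => 1) ω = 1) :
    p = 0 ∧ ∃ c : ℝ, 0 < c ∧ ∀ ω, h ω = c := by
  have hsum : ∀ (f : MarkovShift A → ℝ) (x : MarkovShift A), ∀ c : ℝ,
      transfer φ (fun y => c - f y) x = c - transfer φ f x := by
    intro f x c
    have _ := Fintype.ofFinite {y : MarkovShift A // shift y = x}
    have h1 := hone x
    simp only [transfer, tsum_fintype, mul_one] at h1 ⊢
    simp only [mul_sub, Finset.sum_sub_distrib, ← Finset.sum_mul, h1, one_mul]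
  have hnonneg : ∀ (f : MarkovShift A → ℝ) (x : MarkovShift A), (∀ y, 0 ≤ f y) →
      0 ≤ transfer φ f x := fun f x hf =>
    tsum_nonneg fun y => mul_nonneg (Real.exp_pos _).le (hf _)
  obtain ⟨x, -, hx⟩ := isCompact_univ.exists_isMaxOn Set.univ_nonempty hcont.continuousOn
  obtain ⟨x', -, hx'⟩ := isCompact_univ.exists_isMinOn Set.univ_nonempty hcont.continuousOn
  have hx : ∀ y, h y ≤ h x := fun y => hx (Set.mem_univ y)
  have hx' : ∀ y, h x' ≤ h y := fun y => hx' (Set.mem_univ y)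
  -- An average of `h` is at most its maximum and at least its minimum; compare at points where
  -- these are attained.
  have hp : Real.exp p = 1 := by
    apply le_antisymm
    · have := hnonneg _ x fun y => sub_nonneg.2 (hx y)
      rw [hsum, heig] at this
      nlinarith [hpos x]
    · have := hnonneg (fun y => -(h x' - h y)) x' fun y => by linarith [hx' y]
      have e : transfer φ (fun y => -(h x' - h y)) x' = -transfer φ (fun y => h x' - h y) x' := by
        simp only [transfer, mul_neg, tsum_neg]
      rw [e, hsum, heig] at this
      nlinarith [hpos x']
  -- An average with positive weights equals the maximum only if every preimage attains it.
  have hback1 : ∀ z, h z = h x → ∀ y, shift y = z → h y = h x := by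
    rintro z hz y rfl
    have _ := Fintype.ofFinite {y' : MarkovShift A // shift y' = shift y}
    have h0 : transfer φ (fun y' => h x - h y') (shift y) = 0 := by
      rw [hsum, heig, hp, hz]; ring
    simp only [transfer, tsum_fintype] at h0
    have := (Finset.sum_eq_zero_iff_of_nonneg fun y' _ =>
      mul_nonneg (Real.exp_pos _).le (sub_nonneg.2 (hx y'.1))).1 h0 ⟨y, rfl⟩ (Finset.mem_univ _)
    have := (mul_eq_zero.1 this).resolve_left (Real.exp_pos _).ne'
    exact (sub_eq_zero.1 this).symm
  have hback : ∀ n y, shift^[n] y = x → h y = h x := by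
    intro n
    induction n with
    | zero => rintro y rfl; rfl
    | succ n ih => exact fun y hy => hback1 _ (ih _ hy) y rfl
  refine ⟨by simpa using hp, h x, hpos x, fun ω => ?_⟩
  obtain ⟨α, hα, K, hK⟩ := hh
  -- Each cylinder around ω contains an iterated preimage of the maximum point x, where `h` is again
  -- maximal.
  have hbound : ∀ n : ℕ, 1 ≤ n → |h ω - h x| ≤ K * Real.exp (-α * n) := fun n hn => by
    obtain ⟨τ, hτ, m, hm⟩ := exists_mem_cylinder_iterate_shift hΨ x (initialWord_mem_words ω hn)
    rw [← hback m τ hm]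
    refine hK n hn ω τ fun i hi => ?_
    rw [hτ i (by simpa using hi)]
    simp [initialWord]
  have hlim : Tendsto (fun n : ℕ => K * Real.exp (-α * n)) atTop (𝓝 0) := by
    have : Tendsto (fun n : ℕ => -α * (n : ℝ)) atTop atBot :=
      tendsto_natCast_atTop_atTop.const_mul_atTop_of_neg (by linarith)
    simpa using (Real.tendsto_exp_atBot.comp this).const_mul K
  have := ge_of_tendsto hlim (eventually_atTop.2 ⟨1, hbound⟩)
  exact sub_eq_zero.1 (abs_eq_zero.1 (le_antisymm this (abs_nonneg _)))

end Dynamics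

/-! ### Reduction to the adjoint Koopman operator and its matrix coefficients. -/

section Operators

variable {I : Type*} {A : I → I → Prop} {G : Type*} [Group G] {Ψ : FreeMonoid I →* G}

lemma iterate_skew (n : ℕ) (x : MarkovShift A × G) :
    (skew Ψ)^[n] x = (shift^[n] x.1, x.2 * Ψ (FreeMonoid.ofList (x.1.initialWord n))) := by
  induction n with
  | zero => simp [initialWord]
  | succ n ih =>
    rw [Function.iterate_succ_apply', ih, Function.iterate_succ_apply', skew, coord_iterate_shift,
      zero_add]
    simp [initialWord, List.range_succ, FreeMonoid.ofList_append, mul_assoc]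

lemma mulOp_const {G : Type*} [MeasurableSpace G] (μ : Measure (MarkovShift A))
    (h : MarkovShift A →ᵇ ℝ) {c : ℝ} (hc : ∀ ω, h ω = c) : mulOp G μ h = c • 1 := by
  ext1 f
  refine Lp.ext ?_
  have h1 := MemLp.coeFn_toLp (memLp_top_comp_fst (G := G) μ h)
  have h2 := (ContinuousLinearMap.mul ℝ ℝ).coeFn_holder (r := 2)
    ((memLp_top_comp_fst (G := G) μ h).toLp _) f
  have h3 := Lp.coeFn_smul c f
  filter_upwards [h1, h2, h3] with x h1 h2 h3
  have e : mulOp G μ h f = (ContinuousLinearMap.mul ℝ ℝ).holder 2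
    ((memLp_top_comp_fst (G := G) μ h).toLp _) f := rfl
  rw [e, h2, h1, hc]
  simp [h3]

variable [Countable G] [MeasurableSpace G] [DiscreteMeasurableSpace G]

lemma perronFrobenius_eq_adjoint {φ : MarkovShift A → ℝ} {h : MarkovShift A →ᵇ ℝ}
    {μ : Measure (MarkovShift A)} [IsProbabilityMeasure μ] (hμ : MeasurePreserving shift μ μ)
    (hφ : totalPressure φ = 0) {c : ℝ} (hc0 : c ≠ 0) (hc : ∀ ω, h ω = c) :
    perronFrobenius Ψ φ h hμ = ContinuousLinearMap.adjoint (koopman (G := G) Ψ hμ) := by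
  have hu : IsUnit (c • (1 : L2 G μ →L[ℝ] L2 G μ)) :=
    ⟨⟨c • 1, c⁻¹ • 1, by simp [smul_smul, hc0], by simp [smul_smul, hc0]⟩, rfl⟩
  have hcomm : (c • 1) * ContinuousLinearMap.adjoint (koopman (G := G) Ψ hμ)
      = ContinuousLinearMap.adjoint (koopman Ψ hμ) * (c • 1) := by simp
  rw [perronFrobenius, hφ, Real.exp_zero, one_smul, mulOp_const μ h hc, hcomm, mul_assoc,
    Ring.mul_inverse_cancel _ hu, mul_one]

lemma koopman_pow_indicatorConstLp {μ : Measure (MarkovShift A)} [IsProbabilityMeasure μ]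
    (hμ : MeasurePreserving shift μ μ) (n : ℕ) {s : Set (MarkovShift A × G)}
    (hs : MeasurableSet s) (hsμ : extMeasure G μ s ≠ ∞) :
    ∃ (ht : MeasurableSet ((skew Ψ)^[n] ⁻¹' s)) (htμ : extMeasure G μ ((skew Ψ)^[n] ⁻¹' s) ≠ ∞),
      (koopman Ψ hμ ^ n) (indicatorConstLp 2 hs hsμ 1) = indicatorConstLp 2 ht htμ 1 := by
  induction n generalizing s with
  | zero => exact ⟨hs, hsμ, rfl⟩
  | succ n ih =>
    have hp := measurePreserving_skew Ψ hμ
    have h1 : koopman Ψ hμ (indicatorConstLp 2 hs hsμ 1)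
        = indicatorConstLp 2 (hp.measurable hs)
          (by rwa [hp.measure_preimage hs.nullMeasurableSet]) (1 : ℝ) :=
      Lp.indicatorConstLp_compMeasurePreserving hs hsμ 1 hp
    obtain ⟨ht, htμ, h2⟩ := ih (hp.measurable hs)
      (by rwa [hp.measure_preimage hs.nullMeasurableSet])
    rw [Function.iterate_succ', Set.preimage_comp]
    refine ⟨ht, htμ, ?_⟩
    rw [pow_succ, mul_apply_eq_comp, h1, h2]

/-- The points whose initial block of length `n` is mapped to `g` by `Ψ`. -/
def returnSet (A : I → I → Prop) (Ψ : FreeMonoid I →* G) (n : ℕ) (g : G) :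
    Set (MarkovShift A) :=
  {ω | Ψ (FreeMonoid.ofList (ω.initialWord n)) = g}

/-- After moving the powers to the other side, both vectors are indicators: the intersection
consists of the points of the fibre over a that the n-th skew iterate sends to the fibre over b. -/
lemma inner_adjoint_koopman_pow_fibreIndicator {μ : Measure (MarkovShift A)}
    [IsProbabilityMeasure μ] (hμ : MeasurePreserving shift μ μ) (n : ℕ) (a b : G) :
    ⟪(ContinuousLinearMap.adjoint (koopman Ψ hμ) ^ n) (fibreIndicator μ a),
      fibreIndicator μ b⟫_ℝ = μ.real (returnSet A Ψ n (a⁻¹ * b)) := by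
  obtain ⟨ht, htμ, h⟩ := koopman_pow_indicatorConstLp (Ψ := Ψ) hμ n
    (measurable_snd (measurableSet_singleton b)) (extMeasure_fibre_ne_top μ b)
  rw [← ContinuousLinearMap.star_eq_adjoint, ← star_pow, ContinuousLinearMap.star_eq_adjoint,
    ContinuousLinearMap.adjoint_inner_left, fibreIndicator, fibreIndicator, h,
    L2.inner_indicatorConstLp_indicatorConstLp _ ht (extMeasure_fibre_ne_top μ a) htμ]
  have e : Prod.snd ⁻¹' {a} ∩ (skew Ψ)^[n] ⁻¹' (Prod.snd ⁻¹' {b})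
      = returnSet A Ψ n (a⁻¹ * b) ×ˢ ({a} : Set G) := by
    ext x
    simp only [Set.mem_inter_iff, Set.mem_preimage, Set.mem_singleton_iff, iterate_skew,
      Set.mem_prod, returnSet, Set.mem_ofPred_eq]
    constructor
    · rintro ⟨rfl, h⟩
      exact ⟨by rw [← h]; group, rfl⟩
    · rintro ⟨h, rfl⟩
      exact ⟨rfl, by rw [h]; group⟩
  rw [e, measureReal_prod_prod]
  simp

end Operators

end MarkovShift

/-! ### Return probabilities and pressure. -/

namespace MarkovShift

section Pressure

variable {I : Type*} {A : I → I → Prop} {G : Type*} [Group G] {Ψ : FreeMonoid I →* G}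

lemma measurableSet_cylinder (w : List I) : MeasurableSet (cylinder A w) := by
  let _ : TopologicalSpace I := ⊥
  have _ : DiscreteTopology I := ⟨rfl⟩
  have h : cylinder A w = ⋂ (i : ℕ) (hi : i < w.length), {ω | ω.coord i = w[i]} := by
    ext ω; simp [cylinder]
  rw [h]
  refine MeasurableSet.iInter fun i => MeasurableSet.iInter fun hi => ?_
  exact ((isOpen_discrete {w[i]}).preimage (continuous_letter (A := A) id i)).measurableSet

lemma nonempty_cylinder [Nonempty (MarkovShift A)] (hΨ : IdConnected A Ψ) {w : List I}
    (hw : w ∈ words A) : Nonempty (cylinder A w) := by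
  obtain ⟨τ, hτ, -⟩ := exists_mem_cylinder_iterate_shift hΨ (Classical.arbitrary _) hw
  exact ⟨τ, hτ⟩

/-- Nonemptiness of the cylinder matters: the supremum over an empty cylinder is 0 by convention. -/
lemma wordSum_one [Nonempty (MarkovShift A)] (hΨ : IdConnected A Ψ) {w : List I}
    (hw : w ∈ words A) : wordSum (A := A) (fun _ => 1) w = w.length := by
  have := nonempty_cylinder hΨ hw
  simp [wordSum, birkhoffSum]

/-- The Gibbs property for vanishing pressure compares `μ[w]` and `exp (S_w φ)`. -/
lemma IsGibbs.exists_bounds {φ : MarkovShift A → ℝ} {μ : Measure (MarkovShift A)}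
    [Nonempty (MarkovShift A)] (hΨ : IdConnected A Ψ) (hG : IsGibbs φ μ)
    (hφ : totalPressure φ = 0) :
    ∃ C : ℝ, 0 < C ∧ ∀ w ∈ words A, μ.real (cylinder A w) ≤ C * Real.exp (wordSum φ w) ∧
      Real.exp (wordSum φ w) ≤ C * μ.real (cylinder A w) := by
  obtain ⟨C, hC, h⟩ := hG
  refine ⟨C, hC, fun w hw => ?_⟩
  have hne := nonempty_cylinder hΨ hw
  have hb : ∀ τ : cylinder A w,
      μ.real (cylinder A w) ≤ C * Real.exp (birkhoffSum shift φ w.length τ.1) ∧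
      Real.exp (birkhoffSum shift φ w.length τ.1) ≤ C * μ.real (cylinder A w) := by
    intro τ
    obtain ⟨h1, h2⟩ := h w hw τ.1 τ.2
    rw [hφ, mul_zero, sub_zero] at h1 h2
    rw [div_le_iff₀ (Real.exp_pos _)] at h2
    rw [le_div_iff₀ (Real.exp_pos _), inv_mul_le_iff₀ hC] at h1
    exact ⟨h2, h1⟩
  obtain ⟨τ⟩ := hne
  have hpos : 0 < C * μ.real (cylinder A w) := (Real.exp_pos _).trans_le (hb τ).2
  -- The Gibbs property itself bounds the ergodic sums on the cylinder, so the supremum in `wordSum`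
  -- is a genuine one.
  have hle : ∀ τ : cylinder A w, birkhoffSum shift φ w.length τ.1
      ≤ Real.log (C * μ.real (cylinder A w)) := fun τ =>
    (Real.le_log_iff_exp_le hpos).2 (hb τ).2
  constructor
  · refine (hb τ).1.trans ?_
    gcongr
    exact le_ciSup (f := fun τ : cylinder A w => birkhoffSum shift φ w.length τ.1)
      ⟨_, Set.forall_mem_range.2 hle⟩ τ
  · have : Nonempty (cylinder A w) := ⟨τ⟩
    exact (Real.le_log_iff_exp_le hpos).1 (ciSup_le hle)

/-- The sum of `exp (S_w φ)` over all words `w` of length `⌊T⌋` with `Ψ w = g`. -/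
def windowSum (Ψ : FreeMonoid I →* G) (φ : MarkovShift A → ℝ) (g : G) (T : ℝ) : ℝ≥0∞ :=
  ∑' w : {w : List I // w ∈ fibreWords A Ψ g ∧ T - 1 < wordSum (A := A) (fun _ => 1) w ∧
    wordSum (A := A) (fun _ => 1) w ≤ T}, ENNReal.ofReal (Real.exp (wordSum φ w.1))

/-- The window selects exactly the words of length `⌊T⌋₊`, whose cylinders are disjoint; `1 ≤ T`
excludes the empty word. -/
lemma measure_returnSet [Countable I] [Nonempty (MarkovShift A)] (hΨ : IdConnected A Ψ)
    (μ : Measure (MarkovShift A)) (g : G) {T : ℝ} (hT : 1 ≤ T) :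
    μ (returnSet A Ψ ⌊T⌋₊ g) =
      ∑' w : {w : List I // w ∈ fibreWords A Ψ g ∧ T - 1 < wordSum (A := A) (fun _ => 1) w ∧
        wordSum (A := A) (fun _ => 1) w ≤ T}, μ (cylinder A w.1) := by
  have hlen : ∀ w ∈ words A, (T - 1 < wordSum (A := A) (fun _ => 1) w ∧
      wordSum (A := A) (fun _ => 1) w ≤ T) ↔ w.length = ⌊T⌋₊ := by
    intro w hw
    rw [wordSum_one hΨ hw, eq_comm, Nat.floor_eq_iff (by linarith)]
    constructor
    · rintro ⟨h1, h2⟩; exact ⟨h2, by linarith⟩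
    · rintro ⟨h1, h2⟩; exact ⟨by linarith, h1⟩
  rw [← measure_iUnion _ fun w => measurableSet_cylinder _]
  · congr 1
    ext ω
    rw [Set.mem_iUnion]
    constructor
    · intro h
      have hw := initialWord_mem_words ω (Nat.le_floor (by simpa using hT) : 1 ≤ ⌊T⌋₊)
      exact ⟨⟨_, ⟨hw, h⟩, (hlen _ hw).2 (by simp)⟩, mem_cylinder_iff.2 (by simp)⟩
    · rintro ⟨⟨w, ⟨hw, hg⟩, hl⟩, h⟩
      have := mem_cylinder_iff.1 h
      simp only [(hlen w hw).1 hl] at this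
      rw [returnSet, Set.mem_ofPred_eq, this, hg]
  · intro w v hne
    refine Set.disjoint_left.2 fun ω h h' => hne (Subtype.ext ?_)
    have h1 := mem_cylinder_iff.1 h
    have h2 := mem_cylinder_iff.1 h'
    rw [(hlen _ w.2.1.1).1 w.2.2] at h1
    rw [(hlen _ v.2.1.1).1 v.2.2] at h2
    exact h1.symm.trans h2

lemma windowSum_bounds [Countable I] [Nonempty (MarkovShift A)] (hΨ : IdConnected A Ψ)
    {φ : MarkovShift A → ℝ} {μ : Measure (MarkovShift A)} [IsFiniteMeasure μ] {C : ℝ}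
    (hC : ∀ w ∈ words A, μ.real (cylinder A w) ≤ C * Real.exp (wordSum φ w) ∧
      Real.exp (wordSum φ w) ≤ C * μ.real (cylinder A w)) (hC0 : 0 < C) (g : G) {T : ℝ}
    (hT : 1 ≤ T) :
    windowSum Ψ φ g T ≤ ENNReal.ofReal C * μ (returnSet A Ψ ⌊T⌋₊ g) ∧
      μ (returnSet A Ψ ⌊T⌋₊ g) ≤ ENNReal.ofReal C * windowSum Ψ φ g T := by
  rw [measure_returnSet hΨ μ g hT, windowSum, ← ENNReal.tsum_mul_left, ← ENNReal.tsum_mul_left]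
  constructor
  · refine ENNReal.tsum_le_tsum fun w => ?_
    rw [← ofReal_measureReal, ← ENNReal.ofReal_mul hC0.le]
    exact ENNReal.ofReal_le_ofReal (hC _ w.2.1.1).2
  · refine ENNReal.tsum_le_tsum fun w => ?_
    rw [← ofReal_measureReal, ← ENNReal.ofReal_mul hC0.le]
    exact ENNReal.ofReal_le_ofReal (hC _ w.2.1.1).1

lemma pressure_fibreWords (φ : MarkovShift A → ℝ) (g : G) :
    pressure φ (fibreWords A Ψ g) =
      limsup (fun T : ℝ => ((1 / T : ℝ) : EReal) * ENNReal.log (windowSum Ψ φ g T)) atTop := rfl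

/-- Exponential bounds on the return probabilities bound the pressure from above. -/
theorem pressure_fibreWords_le [Countable I] [Nonempty (MarkovShift A)] (hΨ : IdConnected A Ψ)
    {φ : MarkovShift A → ℝ} {μ : Measure (MarkovShift A)} [IsFiniteMeasure μ]
    (hG : IsGibbs φ μ) (hφ : totalPressure φ = 0) (g : G) {b D : ℝ}
    (h : ∀ n : ℕ, μ.real (returnSet A Ψ n g) ≤ D * Real.exp (b * n)) :
    pressure φ (fibreWords A Ψ g) ≤ b := by
  obtain ⟨C, hC0, hC⟩ := hG.exists_bounds hΨ hφ
  have hD : 0 ≤ D := by simpa using measureReal_nonneg.trans (h 0)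
  rw [pressure_fibreWords, ← EReal.le_of_forall_lt_iff_le]
  intro z hz
  have hz : b < z := by exact_mod_cast hz
  refine limsup_le_of_le (by isBoundedDefault) ?_
  have ht : Tendsto (fun T : ℝ => Real.exp ((z - b) * T)) atTop atTop :=
    Real.tendsto_exp_atTop.comp (tendsto_id.const_mul_atTop (sub_pos.2 hz))
  filter_upwards [eventually_ge_atTop 1,
    ht.eventually (eventually_ge_atTop (C * (D * Real.exp |b|)))] with T hT hlarge
  have hT0 : 0 < T := by linarith
  have hn1 := Nat.floor_le hT0.le
  have hn2 := Nat.lt_floor_add_one T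
  -- Rounding T costs at most a factor `exp |b|`, absorbed with the other constants by the gap `z -
  -- b`.
  have hbn : b * ⌊T⌋₊ ≤ |b| + b * T := by
    have : b * (⌊T⌋₊ - T) ≤ |b| := by
      refine (le_abs_self _).trans ?_
      rw [abs_mul]
      refine mul_le_of_le_one_right (abs_nonneg _) ?_
      rw [abs_le]; constructor <;> linarith
    linarith
  have hW : windowSum Ψ φ g T ≤ ENNReal.ofReal (Real.exp (z * T)) := by
    refine (windowSum_bounds hΨ hC hC0 g hT).1.trans ?_
    rw [← ofReal_measureReal, ← ENNReal.ofReal_mul hC0.le]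
    refine ENNReal.ofReal_le_ofReal ?_
    calc C * μ.real (returnSet A Ψ ⌊T⌋₊ g) ≤ C * (D * Real.exp (|b| + b * T)) := by
          gcongr
          exact (h _).trans (by gcongr)
      _ = C * (D * Real.exp |b|) * Real.exp (b * T) := by rw [Real.exp_add]; ring
      _ ≤ Real.exp ((z - b) * T) * Real.exp (b * T) := by gcongr
      _ = Real.exp (z * T) := by rw [← Real.exp_add]; ring_nf
  have hlog := ENNReal.log_le_log hW
  rw [ENNReal.log_ofReal_of_pos (Real.exp_pos _), Real.log_exp] at hlog
  calc ((1 / T : ℝ) : EReal) * ENNReal.log (windowSum Ψ φ g T)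
      ≤ ((1 / T : ℝ) : EReal) * ((z * T : ℝ) : EReal) :=
        mul_le_mul_of_nonneg_left hlog (by exact_mod_cast (by positivity : 0 ≤ 1 / T))
    _ = z := by
        rw [← EReal.coe_mul]
        congr 1
        field_simp

/-- Upper bounds on the pressure give exponential bounds on the return probabilities. -/
theorem exists_measureReal_returnSet_le [Countable I] [Nonempty (MarkovShift A)]
    (hΨ : IdConnected A Ψ) {φ : MarkovShift A → ℝ} {μ : Measure (MarkovShift A)}
    [IsProbabilityMeasure μ] (hG : IsGibbs φ μ) (hφ : totalPressure φ = 0) (g : G) {b : ℝ}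
    (hb : pressure φ (fibreWords A Ψ g) < b) :
    ∃ D : ℝ, ∀ n : ℕ, μ.real (returnSet A Ψ n g) ≤ D * Real.exp (b * n) := by
  obtain ⟨C, hC0, hC⟩ := hG.exists_bounds hΨ hφ
  rw [pressure_fibreWords] at hb
  have hev := tendsto_natCast_atTop_atTop.eventually (eventually_lt_of_limsup_lt hb)
  obtain ⟨n₀, hn₀⟩ := eventually_atTop.1 (hev.and (eventually_ge_atTop 1))
  -- The Gibbs constant C serves `n ≥ n₀`; for smaller n the other term suffices, as probabilities
  -- are at most 1.
  refine ⟨C + Real.exp (|b| * n₀), fun n => ?_⟩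
  by_cases hn : n < n₀
  · have h1 : 1 ≤ Real.exp (|b| * n₀) * Real.exp (b * n) := by
      rw [← Real.exp_add]
      refine Real.one_le_exp ?_
      have h2 : |b| * n ≤ |b| * n₀ := by gcongr
      have h3 : -|b| * n ≤ b * n := by gcongr; exact neg_abs_le b
      linarith
    have h4 : 0 ≤ C * Real.exp (b * n) := by positivity
    rw [add_mul]
    linarith [measureReal_le_one (μ := μ) (s := returnSet A Ψ n g)]
  · obtain ⟨h, hn1⟩ := hn₀ n (not_lt.1 hn)
    have hn1' : (1 : ℝ) ≤ n := by exact_mod_cast hn1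
    have hlog : ENNReal.log (windowSum Ψ φ g n) ≤ ((b * n : ℝ) : EReal) := by
      have h' := mul_le_mul_of_nonneg_left h.le
        (by exact_mod_cast (by positivity : (0 : ℝ) ≤ n) : (0 : EReal) ≤ ((n : ℝ) : EReal))
      rwa [← mul_assoc, ← EReal.coe_mul, mul_one_div_cancel (by positivity), EReal.coe_one,
        one_mul, ← EReal.coe_mul, mul_comm (n : ℝ)] at h'
    have hW : windowSum Ψ φ g n ≤ ENNReal.ofReal (Real.exp (b * n)) := by
      rwa [← ENNReal.log_le_log_iff, ENNReal.log_ofReal_of_pos (Real.exp_pos _), Real.log_exp]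
    have := ((windowSum_bounds hΨ hC hC0 g hn1').2.trans (mul_le_mul_right hW _))
    rw [Nat.floor_natCast, ← ofReal_measureReal, ← ENNReal.ofReal_mul hC0.le,
      ENNReal.ofReal_le_ofReal_iff (by positivity)] at this
    refine this.trans ?_
    gcongr
    linarith [Real.exp_pos (|b| * n₀)]

end Pressure

end MarkovShift

/-! ### The cone of non-negative functions in `L²` -/

section NonnegCone

variable {α : Type*} [MeasurableSpace α] {ν : Measure α}

lemma L2_inner_nonneg {f g : Lp ℝ 2 ν} (hf : 0 ≤ f) (hg : 0 ≤ g) : 0 ≤ ⟪f, g⟫_ℝ := by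
  rw [L2.inner_def]
  refine integral_nonneg_of_ae ?_
  filter_upwards [(Lp.coeFn_nonneg f).2 hf, (Lp.coeFn_nonneg g).2 hg] with x h1 h2
  exact mul_nonneg h2 h1

lemma L2_inner_posPart_negPart (f : Lp ℝ 2 ν) : ⟪f⁺, f⁻⟫_ℝ = 0 := by
  rw [L2.inner_def]
  refine integral_eq_zero_of_ae ?_
  filter_upwards [Lp.coeFn_sup f 0, Lp.coeFn_sup (-f) 0, Lp.coeFn_neg f, Lp.coeFn_zero ℝ 2 ν]
    with x h1 h2 h3 h4
  rw [posPart_def, negPart_def, h1, h2]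
  simp only [Pi.sup_apply, h3, h4, Pi.neg_apply, Pi.zero_apply]
  rcases le_total 0 (f x) with h | h
  · rw [sup_eq_right.2 (neg_nonpos.2 h), inner_zero_right]
  · rw [sup_eq_right.2 h, inner_zero_left]

/-- The non-negative functions in a subspace of `L²`. -/
def nonnegCone (V : Submodule ℝ (Lp ℝ 2 ν)) : Set V := {f | 0 ≤ (f : Lp ℝ 2 ν)}

/-- As V contains negative parts, it can test positivity by itself: pairing f with its own negative
part gives `-‖f⁻‖²`, which is non-negative only if `f⁻ = 0`. -/
lemma isSelfDualCone_nonnegCone {V : Submodule ℝ (Lp ℝ 2 ν)} (hV : ∀ f ∈ V, f⁻ ∈ V) :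
    IsSelfDualCone (nonnegCone V) := by
  have hdec : ∀ f : V, ∃ p ∈ nonnegCone V, ∃ q ∈ nonnegCone V, f = p - q ∧ ⟪p, q⟫_ℝ = 0 := by
    intro f
    have hp : (f : Lp ℝ 2 ν)⁺ ∈ V := by
      have := V.add_mem f.2 (hV f f.2)
      rwa [← eq_add_of_sub_eq (posPart_sub_negPart (f : Lp ℝ 2 ν))] at this
    refine ⟨⟨_, hp⟩, posPart_nonneg (f : Lp ℝ 2 ν), ⟨_, hV f f.2⟩,
      negPart_nonneg (f : Lp ℝ 2 ν), Subtype.ext ?_, L2_inner_posPart_negPart _⟩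
    exact (posPart_sub_negPart (f : Lp ℝ 2 ν)).symm
  refine ⟨fun f hf g hg => L2_inner_nonneg hf hg, fun f hf => ?_, hdec⟩
  obtain ⟨p, hp, q, hq, rfl, hpq⟩ := hdec f
  have h := hf q hq
  rw [inner_sub_left, hpq, real_inner_self_eq_norm_sq] at h
  have hq0 : q = 0 := norm_eq_zero.1 (by nlinarith [norm_nonneg q])
  rwa [hq0, sub_zero]

lemma inf_mem_of_negPart_mem {V : Submodule ℝ (Lp ℝ 2 ν)} (hV : ∀ f ∈ V, f⁻ ∈ V)
    {f g : Lp ℝ 2 ν} (hf : f ∈ V) (hg : g ∈ V) : f ⊓ g ∈ V := by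
  have h : f ⊓ g = f - (g - f)⁻ := by
    rw [← posPart_neg, neg_sub, inf_eq_sub_posPart_sub]
  rw [h]
  exact V.sub_mem hf (hV _ (V.sub_mem hg hf))

end NonnegCone

lemma inner_apply_smul_sum {E ι : Type*} [NormedAddCommGroup E] [InnerProductSpace ℝ E]
    (S : E →L[ℝ] E) (k : ℝ) (F : Finset ι) (e : ι → E) :
    ⟪S (k • ∑ a ∈ F, e a), k • ∑ a ∈ F, e a⟫_ℝ = k ^ 2 * ∑ a ∈ F, ∑ b ∈ F, ⟪S (e a), e b⟫_ℝ := by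
  simp only [map_smul, map_sum, inner_smul_left, inner_smul_right, sum_inner, inner_sum,
    conj_trivial]
  rw [← Finset.mul_sum, ← mul_assoc, ← pow_two, Finset.sum_comm]

/-! ### Truncation to finitely many fibres; positivity of the Koopman operator. -/

namespace MarkovShift

variable {I : Type*} {A : I → I → Prop} {G : Type*} [Countable G]
  [MeasurableSpace G] [DiscreteMeasurableSpace G]
  {μ : Measure (MarkovShift A)} [IsProbabilityMeasure μ]

lemma fibreIndicator_nonneg (g : G) : 0 ≤ fibreIndicator μ g := by
  rw [← Lp.coeFn_nonneg]
  filter_upwards [indicatorConstLp_coeFn (μ := extMeasure G μ) (p := 2)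
    (hs := measurable_snd (measurableSet_singleton g)) (hμs := extMeasure_fibre_ne_top μ g)
    (c := (1 : ℝ))] with x hx
  rw [fibreIndicator, hx]
  exact Set.indicator_nonneg (fun _ _ => zero_le_one) _

lemma coeFn_sum_fibreIndicator [DecidableEq G] (F : Finset G) :
    ⇑(∑ g ∈ F, fibreIndicator μ g) =ᵐ[extMeasure G μ] fun x => if x.2 ∈ F then 1 else 0 := by
  induction F using Finset.induction_on with
  | empty =>
    filter_upwards [Lp.coeFn_zero ℝ 2 (extMeasure G μ)] with x hx
    rw [Finset.sum_empty, if_neg (Finset.notMem_empty _)]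
    exact hx
  | insert a F ha ih =>
    rw [Finset.sum_insert ha]
    filter_upwards [Lp.coeFn_add (fibreIndicator μ a) (∑ g ∈ F, fibreIndicator μ g), ih,
      indicatorConstLp_coeFn (μ := extMeasure G μ) (p := 2)
        (hs := measurable_snd (measurableSet_singleton a)) (hμs := extMeasure_fibre_ne_top μ a)
        (c := (1 : ℝ))] with x h1 h2 h3
    rw [h1, Pi.add_apply, h2, fibreIndicator, h3]
    by_cases hx : x.2 = a
    · simp [hx, ha]
    · simp [hx]

/-- Functions that are dominated by a multiple of the indicator of finitely many fibres. -/
def IsFibreDominated (f : L2 G μ) : Prop :=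
  ∃ c : ℝ, ∃ F : Finset G, f ≤ c • ∑ g ∈ F, fibreIndicator μ g

/-- Truncation of a non-negative function converges to it. -/
lemma tendsto_inf_smul_sum_fibreIndicator {f : L2 G μ} (hf : 0 ≤ f) :
    Tendsto (fun k : ℕ × Finset G => f ⊓ ((k.1 : ℝ) • ∑ g ∈ k.2, fibreIndicator μ g)) atTop
      (𝓝 f) := by
  classical
  set u : ℕ × Finset G → L2 G μ := fun k => (k.1 : ℝ) • ∑ g ∈ k.2, fibreIndicator μ g with hu
  set w : ℕ × Finset G → L2 G μ := fun k => f ⊓ u k - f with hw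
  have hae : ∀ᵐ x ∂extMeasure G μ, 0 ≤ f x ∧ ∀ k : ℕ × Finset G,
      w k x = min (f x) (k.1 * if x.2 ∈ k.2 then 1 else 0) - f x := by
    refine ((Lp.coeFn_nonneg f).2 hf).and (ae_all_iff.2 fun k => ?_)
    filter_upwards [Lp.coeFn_sub (f ⊓ u k) f, Lp.coeFn_inf f (u k),
      Lp.coeFn_smul (k.1 : ℝ) (∑ g ∈ k.2, fibreIndicator μ g),
      coeFn_sum_fibreIndicator (μ := μ) k.2] with x h1 h2 h3 h4
    rw [hw, h1, Pi.sub_apply, h2, Pi.inf_apply, hu, h3, Pi.smul_apply, h4, smul_eq_mul]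
  have hsq : Tendsto (fun k => ‖w k‖ ^ 2) atTop (𝓝 0) := by
    have e : ∀ k, ‖w k‖ ^ 2 = ∫ x, ⟪w k x, w k x⟫_ℝ ∂extMeasure G μ := fun k => by
      rw [← real_inner_self_eq_norm_sq, L2.inner_def]
    simp only [e]
    rw [← integral_zero (MarkovShift A × G) ℝ (μ := extMeasure G μ)]
    -- The truncation error lies between `-f` and 0, and vanishes at x once the height exceeds `f x`
    -- and the finite set contains `x.2`.
    refine tendsto_integral_filter_of_dominated_convergence (fun x => ⟪f x, f x⟫_ℝ)
      (Eventually.of_forall fun k => (L2.integrable_inner (𝕜 := ℝ) (w k) (w k)).aestronglyMeasurable)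
      (Eventually.of_forall fun k => ?_) (L2.integrable_inner (𝕜 := ℝ) f f) ?_
    · filter_upwards [hae] with x ⟨h0, hx⟩
      rw [real_inner_self_eq_norm_sq, real_inner_self_eq_norm_sq, norm_pow, norm_norm, hx]
      gcongr
      have : 0 ≤ (k.1 : ℝ) * if x.2 ∈ k.2 then 1 else 0 := by positivity
      rw [Real.norm_eq_abs, Real.norm_eq_abs, abs_of_nonneg h0, abs_le]
      constructor
      · linarith [le_min h0 this]
      · linarith [min_le_left (f x) ((k.1 : ℝ) * if x.2 ∈ k.2 then 1 else 0)]
    · filter_upwards [hae] with x ⟨h0, hx⟩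
      refine tendsto_const_nhds.congr' ?_
      filter_upwards [eventually_ge_atTop ((⌈f x⌉₊, {x.2}) : ℕ × Finset G)] with k hk
      have h1 : f x ≤ k.1 := (Nat.le_ceil _).trans (by exact_mod_cast hk.1)
      have h2 : x.2 ∈ k.2 := hk.2 (Finset.mem_singleton_self _)
      rw [hx, if_pos h2, mul_one, min_eq_left h1, sub_self, inner_zero_left]
  rw [tendsto_iff_norm_sub_tendsto_zero]
  have := hsq.sqrt
  simpa only [Real.sqrt_sq (norm_nonneg _), Real.sqrt_zero] using this

/-- The truncations stay in V, which is a sublattice containing the fibre indicators. -/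
lemma nonnegCone_subset_closure {V : Submodule ℝ (L2 G μ)} (hVneg : ∀ f ∈ V, f⁻ ∈ V)
    (hVind : ∀ g : G, fibreIndicator μ g ∈ V) :
    nonnegCone V ⊆ closure {f | f ∈ nonnegCone V ∧ IsFibreDominated (f : L2 G μ)} := by
  classical
  intro f hf
  have hu : ∀ k : ℕ × Finset G, (k.1 : ℝ) • ∑ g ∈ k.2, fibreIndicator μ g ∈ V := fun k =>
    V.smul_mem _ (V.sum_mem fun g _ => hVind g)
  have hlim : Tendsto (fun k : ℕ × Finset G =>
      (⟨_, inf_mem_of_negPart_mem hVneg f.2 (hu k)⟩ : V)) atTop (𝓝 f) :=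
    tendsto_subtype_rng.2 (tendsto_inf_smul_sum_fibreIndicator hf)
  refine mem_closure_of_tendsto hlim (Eventually.of_forall fun k => ⟨?_, ?_⟩)
  · refine le_inf (show (0 : L2 G μ) ≤ f from hf) ?_
    rw [Nat.cast_smul_eq_nsmul]
    refine nsmul_nonneg ?_ _
    exact Finset.sum_nonneg fun g _ => fibreIndicator_nonneg g
  · exact ⟨k.1, k.2, inf_le_right⟩

variable [Group G] {Ψ : FreeMonoid I →* G}

lemma koopman_nonneg (hμ : MeasurePreserving shift μ μ) {f : L2 G μ} (hf : 0 ≤ f) :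
    0 ≤ koopman Ψ hμ f := by
  have hp := measurePreserving_skew (G := G) Ψ hμ
  rw [← Lp.coeFn_nonneg] at hf ⊢
  filter_upwards [Lp.coeFn_compMeasurePreserving f hp, hp.quasiMeasurePreserving.ae hf]
    with x h1 h2
  have e : koopman Ψ hμ f = Lp.compMeasurePreserving (skew Ψ) hp f := rfl
  rw [e, h1]
  exact h2

lemma norm_koopman_le (hμ : MeasurePreserving shift μ μ) : ‖koopman (G := G) Ψ hμ‖ ≤ 1 :=
  LinearIsometry.norm_toContinuousLinearMap_le _

end MarkovShift

/-- The square root of `c_n (N_n + 1)` is subexponential if `c` is and `N` is sublinear. -/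
lemma tendsto_sqrt_mul_rpow_one_div {c : ℕ → ℝ} {N : ℕ → ℕ} (hc0 : ∀ n, 0 < c n)
    (hc : Tendsto (fun n : ℕ => c n ^ (1 / (n : ℝ))) atTop (𝓝 1))
    (hN : Tendsto (fun n : ℕ => (N n : ℝ) / n) atTop (𝓝 0)) :
    Tendsto (fun n : ℕ => √(c n * (N n + 1)) ^ (1 / (n : ℝ))) atTop (𝓝 1) := by
  -- Eventually `N n < n`, hence `1 ≤ N n + 1 ≤ n ^ 2`, which squeezes the n-th roots.
  have h1 : Tendsto (fun n : ℕ => ((n : ℝ) ^ (1 / (n : ℝ))) ^ 2) atTop (𝓝 1) := by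
    simpa using ((tendsto_rpow_div).comp tendsto_natCast_atTop_atTop).pow 2
  have h2 : Tendsto (fun n : ℕ => ((N n : ℝ) + 1) ^ (1 / (n : ℝ))) atTop (𝓝 1) := by
    refine tendsto_of_tendsto_of_tendsto_of_le_of_le' tendsto_const_nhds h1 ?_ ?_
    · exact Eventually.of_forall fun n => Real.one_le_rpow (by simp) (by positivity)
    · filter_upwards [hN.eventually (gt_mem_nhds zero_lt_one), eventually_ge_atTop 2] with n hn hn2
      have hn2' : (2 : ℝ) ≤ n := by exact_mod_cast hn2
      rw [div_lt_one (by positivity)] at hn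
      rw [← Real.rpow_natCast, ← Real.rpow_mul (by positivity), mul_comm, Real.rpow_mul
        (by positivity), Real.rpow_natCast]
      gcongr
      nlinarith
  have h3 := (hc.mul h2).sqrt
  rw [mul_one, Real.sqrt_one] at h3
  refine h3.congr fun n => ?_
  have : 0 ≤ c n := (hc0 n).le
  rw [← Real.mul_rpow this (by positivity), Real.sqrt_eq_rpow, Real.sqrt_eq_rpow,
    ← Real.rpow_mul (by positivity), ← Real.rpow_mul (by positivity), mul_comm (1 / 2 : ℝ)]

end

/-! ### Comparison of pressure and spectral radius. -/

theorem mainTheorem6 {I : Type*} [Finite I] (A : I → I → Prop)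
    {G : Type*} [Group G] [Countable G] [MeasurableSpace G] [DiscreteMeasurableSpace G]
    (Ψ : FreeMonoid I →* G) (hΨ : MarkovShift.IdConnected A Ψ)
    (φ : MarkovShift A → ℝ) (hφ : MarkovShift.IsHolder φ)
    (μ : Measure (MarkovShift A)) [IsProbabilityMeasure μ]
    (hμ : MeasurePreserving MarkovShift.shift μ μ) (hGibbs : MarkovShift.IsGibbs φ μ)
    (h : MarkovShift A →ᵇ ℝ) (hh : MarkovShift.IsHolder h) (hpos : ∀ ω, 0 < h ω)
    (heig : ∀ ω, MarkovShift.transfer φ h ω = Real.exp (MarkovShift.totalPressure φ) * h ω)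
    (hone : ∀ ω, MarkovShift.transfer φ (fun _ => 1) ω = 1)
    (V : Submodule ℝ (MarkovShift.L2 G μ))
    (hVclosed : IsClosed (V : Set (MarkovShift.L2 G μ)))
    (hVinv : ∀ f ∈ V, MarkovShift.perronFrobenius Ψ φ h hμ f ∈ V)
    (hVneg : ∀ f ∈ V, f⁻ ∈ V)
    (hVind : ∀ g : G, MarkovShift.fibreIndicator μ g ∈ V)
    (hasa : MarkovShift.IsAsymptoticallySelfAdjoint
      ((MarkovShift.perronFrobenius Ψ φ h hμ).restrict hVinv)) :
    ⨆ g : G, MarkovShift.pressure φ (MarkovShift.fibreWords A Ψ g) =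
      ENNReal.log (realSpectralRadius
        ((MarkovShift.perronFrobenius Ψ φ h hμ).restrict hVinv)) := by
  have hne : Nonempty (MarkovShift A) := nonempty_of_isProbabilityMeasure μ
  have _ : CompleteSpace V := hVclosed.completeSpace_coe
  obtain ⟨hp0, κ, hκ, hconst⟩ :=
    MarkovShift.eigenfunction_eq_const hΨ h.continuous hh hpos heig hone
  have hadj := MarkovShift.perronFrobenius_eq_adjoint (Ψ := Ψ) hμ hp0 hκ.ne' hconst
  set P := MarkovShift.perronFrobenius Ψ φ h hμ
  set T : V →L[ℝ] V := P.restrict hVinv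
  have hTcoe : ∀ f : V, ((T f : V) : MarkovShift.L2 G μ) = P f := fun f => rfl
  have hTpow : ∀ (n : ℕ) (f : V), (((T ^ n) f : V) : MarkovShift.L2 G μ) = (P ^ n) f := by
    intro n
    induction n with
    | zero => exact fun f => rfl
    | succ n ih =>
      intro f
      rw [pow_succ, pow_succ, mul_apply_eq_comp, mul_apply_eq_comp, ih, hTcoe]
  let e : G → V := fun g => ⟨MarkovShift.fibreIndicator μ g, hVind g⟩
  have hinner : ∀ (n : ℕ) (a b : G), ⟪(T ^ n) (e a), e b⟫_ℝ
      = μ.real (MarkovShift.returnSet A Ψ n (a⁻¹ * b)) := fun n a b => by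
    rw [Submodule.coe_inner, hTpow, hadj]
    exact MarkovShift.inner_adjoint_koopman_pow_fibreIndicator hμ n a b
  have hnorm : ‖T‖ ≤ 1 := by
    refine T.opNorm_le_bound zero_le_one fun f => ?_
    have hn : ‖ContinuousLinearMap.adjoint (MarkovShift.koopman (G := G) Ψ hμ)‖ ≤ 1 := by
      rw [LinearIsometryEquiv.norm_map]
      exact MarkovShift.norm_koopman_le hμ
    calc ‖T f‖ = ‖P f‖ := by rw [← hTcoe]; rfl
      _ ≤ 1 * ‖f‖ := by rw [hadj]; exact ContinuousLinearMap.le_of_opNorm_le _ hn _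
  have hcone := isSelfDualCone_nonnegCone hVneg
  -- By duality from the Koopman operator; the pairing is taken in the full `L2`, so V need not be
  -- Koopman-invariant.
  have hTK : ∀ f ∈ nonnegCone V, T f ∈ nonnegCone V := fun f hf =>
    hcone.mem_of_inner_nonneg _ fun g hg => by
      rw [Submodule.coe_inner, hTcoe, hadj, ContinuousLinearMap.adjoint_inner_left]
      exact L2_inner_nonneg hf (MarkovShift.koopman_nonneg hμ hg)
  apply le_antisymm
  · refine iSup_le fun g => EReal.le_of_forall_lt_iff_le.1 fun z hz => ?_
    obtain ⟨D, hD⟩ := exists_norm_pow_le_of_log_lt T hz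
    refine MarkovShift.pressure_fibreWords_le hΨ hGibbs hp0 g (D := D * ‖e 1‖ * ‖e g‖)
      fun n => ?_
    have h1 := hinner n 1 g
    rw [inv_one, one_mul] at h1
    rw [← h1]
    calc ⟪(T ^ n) (e 1), e g⟫_ℝ ≤ ‖(T ^ n) (e 1)‖ * ‖e g‖ := real_inner_le_norm _ _
      _ ≤ D * Real.exp (z * n) * ‖e 1‖ * ‖e g‖ := by
          gcongr
          exact (T ^ n).le_of_opNorm_le (hD n) _
      _ = _ := by ring
  · refine EReal.le_of_forall_lt_iff_le.1 fun b hb => ?_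
    -- For `b ≥ 0` the contraction bound `‖T‖ ≤ 1` suffices; for `b < 0` one has `exp b ≤ 1`, as
    -- `norm_pow_sq_le` requires.
    rcases le_or_gt 0 b with hb0 | hb0
    · refine log_realSpectralRadius_le T (d := fun _ => 1) (fun _ => zero_le_one) (by simp)
        fun n hn => ?_
      calc ‖T ^ n‖ ≤ ‖T‖ ^ n := norm_pow_le' T hn
        _ ≤ 1 := pow_le_one₀ (norm_nonneg T) hnorm
        _ ≤ 1 * Real.exp (b * n) := by
          rw [one_mul]; exact Real.one_le_exp (by positivity)
    · obtain ⟨c, N, hc0, hc, hN, hineq⟩ := hasa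
      refine log_realSpectralRadius_le T (d := fun n => √(c n * (N n + 1)))
        (fun _ => Real.sqrt_nonneg _) (tendsto_sqrt_mul_rpow_one_div hc0 hc hN) fun n hn => ?_
      have hret : ∀ g : G, ∃ D : ℝ, ∀ m : ℕ,
          μ.real (MarkovShift.returnSet A Ψ m g) ≤ D * Real.exp (b * m) := fun g =>
        MarkovShift.exists_measureReal_returnSet_le hΨ hGibbs hp0 g
          ((le_iSup (fun g => MarkovShift.pressure φ (MarkovShift.fibreWords A Ψ g)) g).trans_lt hb)
      choose D hD using hret
      have key := hcone.norm_pow_sq_le hTK (hc0 n) (Real.exp_pos b).le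
        (Real.exp_le_one_iff.2 hb0.le) (fun f hf g hg => hineq f g hf hg n hn)
        (fun f hf => hf.1) (MarkovShift.nonnegCone_subset_closure hVneg hVind) (by
          rintro f ⟨hf, k, F, hle⟩
          let u : V := k • ∑ g ∈ F, e g
          have hcoe : (u : MarkovShift.L2 G μ) = k • ∑ g ∈ F, MarkovShift.fibreIndicator μ g := by
            simp [u, e]
          have hfu : u - f ∈ nonnegCone V := by
            change 0 ≤ ((u - f : V) : MarkovShift.L2 G μ)
            rw [Submodule.coe_sub, hcoe]
            exact sub_nonneg.2 hle
          have hu : u ∈ nonnegCone V := by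
            have h1 : (0 : MarkovShift.L2 G μ) ≤ f := hf
            change 0 ≤ (u : MarkovShift.L2 G μ)
            rw [hcoe]
            exact h1.trans hle
          refine ⟨k ^ 2 * ∑ a ∈ F, ∑ b ∈ F, D (a⁻¹ * b), fun m => ?_⟩
          have hTm := ContinuousLinearMap.pow_mapsTo hTK m
          -- Since `0 ≤ f ≤ u`, positivity gives `⟪T^m f, f⟫ ≤ ⟪T^m f, u⟫ ≤ ⟪T^m u, u⟫`, a finite
          -- sum of return probabilities.
          have h1 := hcone.inner_nonneg _ (hTm f hf) _ hfu
          have h2 := hcone.inner_nonneg _ (hTm _ hfu) _ hu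
          rw [inner_sub_right] at h1
          rw [map_sub, inner_sub_left] at h2
          calc ⟪(T ^ m) f, f⟫_ℝ ≤ ⟪(T ^ m) u, u⟫_ℝ := by linarith
            _ = k ^ 2 * ∑ a ∈ F, ∑ b ∈ F, μ.real (MarkovShift.returnSet A Ψ m (a⁻¹ * b)) := by
              rw [inner_apply_smul_sum]
              simp only [hinner]
            _ ≤ k ^ 2 * ∑ a ∈ F, ∑ b' ∈ F, D (a⁻¹ * b') * Real.exp (b * m) := by
              gcongr with a _ b' _
              exact hD _ m
            _ = _ := by
              simp only [← Finset.sum_mul]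
              rw [← Real.exp_nat_mul, mul_comm (m : ℝ), mul_assoc])
      refine le_of_sq_le_sq (key.trans (le_of_eq ?_)) (by positivity)
      have := (hc0 n).le
      rw [mul_pow, Real.sq_sqrt (by positivity), ← Real.exp_nat_mul, ← Real.exp_nat_mul]
      push_cast
      ring_nf
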